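/- **Setting.** A signature $\Sigma$ is a set of function symbols with finite arities; $\Sigma_\bot=\Sigma\uplus\{\bot\}$ with a fresh constant $\bot$. A graph over $\Sigma$ is a set of nodes $N$ with a labelling $\mathrm{lab}\colon N\to\Sigma$ and a successor function $\mathrm{suc}\colon N\to N^*$ such that a node labelled with a $k$-ary symbol has exactly $k$ successors; a term graph is a graph with a root from which all nodes are reachable. A position of a node is a path (sequence of edge numbers) from the root to it, and its depth is the least length of its positions. A term graph is canonical if every node is the set of its positions; every term graph $g$ is isomorphic to a unique canonical one, $\mathcal C(g)$. Let $\mathcal C^\infty(\Sigma)$ be the set of canonical term graphs over $\Sigma$, viewed as those elements of $\mathcal C^\infty(\Sigma_\bot)$ in which $\bot$ does not occur (the *total* ones). *Order.* For $g,h\in\mathcal C^\infty(\Sigma_\bot)$ put $g\le_\bot^s h$ iff there is a map from the nodes of $g$ to those of $h$ that preserves the root and preserves labels and successors at all nodes of $g$ not labelled $\bot$. The limit inferior of a sequence, $\liminf_{\iota\to\lambda} c_\iota=\bigsqcup_{\beta<\lambda}\bigsqcap_{\beta\le\iota<\lambda}c_\iota$, is taken in this order. *Metric.* The truncation $g\dagger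 d$ keeps the nodes of depth at most $d$; those of depth $d$ are relabelled $\bot$ and lose their outgoing edges. Put $\mathbf d_s(g,g)=0$, and $\mathbf d_s(g,h)=2^{-d}$ for $g\ne h$, where $d$ is the largest $e<\omega$ with $g\dagger e\cong h\dagger e$. *Rewriting.* Let $\mathcal V$ be a set of variables, regarded as additional constants. A term graph rule over $\Sigma$ is a graph over $\Sigma\uplus\mathcal V$ with two nodes $l,r$ from at least one of which each node is reachable, such that each variable labels at most one node, and any such node differs from $l$ and is reachable from $l$. A term graph rewriting system (GRS) $\mathcal R=(\Sigma,R)$ is a signature with a set $R$ of rules over it, and $\mathcal R_\bot=(\Sigma_\bot,R)$. A rule is applied to a term graph $g$ at a node $n$ as follows. Take a map $\varphi$ from the subgraph of the rule rooted in $l$ to the subgraph of $g$ rooted in $n$ that preserves the root, and preserves labels and successors except at variable nodes. Add to $g$ a copy of all rule nodes not reachable from $l$, together with their edges, edges to a node $m$ reachable from $l$ being directed to $\varphi(m)$. Then redirect all edges that point to $n$ to $n'$, where $n'=\varphi(r)$ if $r$ is reachable from $l$ and $n'$ is the copy of $r$ otherwise; if $n$ is the root of $g$, then $n'$ becomes the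 root. Finally remove all nodes not reachable from the root. A reduction step $g\to_n h$ between canonical term graphs is such an application up to isomorphism (that is, after passing to canonical representatives). A reduction $S=(g_\iota\to_{n_\iota}g_{\iota+1})_{\iota<\alpha}$ is a sequence of steps of ordinal length $\alpha$; it is open if $\alpha$ is a limit ordinal and closed otherwise. Its term graphs are the $g_\iota$ with $\iota<\alpha$, and also $g_\alpha$ if $S$ is closed. The reduction context $c_\iota$ of the step at $\iota$ is the canonical representative of the term graph obtained from $g_\iota$ by labelling $n_\iota$ with $\bot$, removing its outgoing edges and then removing all nodes that have become unreachable from the root. *Convergence.* $S$ *strongly $m$-converges in $\mathcal R$* from $g$ to $h$ if $g_0=g$, all term graphs of $S$ and $h$ are total, for each limit ordinal $\lambda<\alpha$ we have $\lim_{\iota\to\lambda}g_\iota=g_\lambda$ with respect to $\mathbf d_s$ and the depth of $n_\iota$ in $g_\iota$ tends to infinity as $\iota\to\lambda$, and either $S$ is closed and $h=g_\alpha$, or $S$ is open, $\lim_{\iota\to\alpha}g_\iota=h$ and the depth of $n_\iota$ in $g_\iota$ tends to infinity as $\iota\to\alpha$. $S$ *strongly $p$-converges in $\mathcal R$* from $g$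 to $h$ if $g_0=g$, $\liminf_{\iota\to\lambda}c_\iota=g_\lambda$ for each limit ordinal $\lambda<\alpha$, and either $S$ is closed and $h=g_\alpha$, or $S$ is open and $h=\liminf_{\iota\to\alpha}c_\iota$. **Theorem.** Let $\mathcal R=(\Sigma,R)$ be a GRS, let $S$ be a reduction in $\mathcal R_\bot$, and let $g,h\in\mathcal C^\infty(\Sigma_\bot)$. Then $S$ strongly $m$-converges in $\mathcal R$ from $g$ to $h$ if and only if $S$ strongly $p$-converges in $\mathcal R$ from $g$ to $h$ and all term graphs of $S$ as well as $h$ are total. -/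

import Mathlib

universe u v w x y

namespace TGR

/-! ### Signatures, graphs, term graphs -/

/-- A signature: a set of function symbols with finite arities. -/
structure Signature where
  Sym : Type u
  ar : Sym → ℕ

/-- The signature `Σ_⊥`: `none` is the fresh constant symbol `⊥`. -/
abbrev Signature.withBot (Sg : Signature.{u}) : Signature.{u} :=
  ⟨Option Sg.Sym, fun s => s.elim 0 Sg.ar⟩

/-- The signature `Σ_V`: every variable `Sum.inr v` is a fresh constant symbol. -/
abbrev Signature.withVars (Sg : Signature.{u}) (V : Type v) : Signature.{max u v} :=
  ⟨Sg.Sym ⊕ V, Sum.elim Sg.ar (fun _ => 0)⟩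

/-- A graph over a signature, with node set `N`: a labelling and a successor function such that a
node labelled with a `k`-ary symbol has exactly `k` (ordered) successors. -/
structure Graph (Sg : Signature.{u}) (N : Type w) where
  lab : N → Sg.Sym
  suc : N → List N
  length_suc : ∀ n, (suc n).length = Sg.ar (lab n)

/-- `g.IsPath n p m`: the sequence `p` of edge numbers is a path from `n` to `m`. -/
inductive Graph.IsPath {Sg : Signature.{u}} {N : Type w} (g : Graph Sg N) :
    N → List ℕ → N → Prop
  | nil (n : N) : Graph.IsPath g n [] n
  | cons {n m k : N} {i : ℕ} {p : List ℕ} :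
      (g.suc n)[i]? = some m → Graph.IsPath g m p k → Graph.IsPath g n (i :: p) k

/-- `m` is reachable from `n`. -/
def Graph.Reach {Sg : Signature.{u}} {N : Type w} (g : Graph Sg N) (n m : N) : Prop :=
  ∃ p, g.IsPath n p m

/-- A term graph: a graph with a root from which all nodes are reachable. -/
structure TermGraph (Sg : Signature.{u}) (N : Type w) extends Graph Sg N where
  root : N
  reachable : ∀ n, toGraph.Reach root n

/-- The graph obtained by reading symbols of one signature as symbols of another one. -/
def Graph.mapSym {Sg : Signature.{u}} {Sg' : Signature.{v}} {N : Type w} (g : Graph Sg N)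
    (f : Sg.Sym → Sg'.Sym) (hf : ∀ s, Sg'.ar (f s) = Sg.ar s) : Graph Sg' N where
  lab n := f (g.lab n)
  suc := g.suc
  length_suc n := by rw [hf, g.length_suc]

section Basic

variable {Sg : Signature.{u}} {N : Type w}

theorem Graph.IsPath.append {g : Graph Sg N} {a b c : N} {p q : List ℕ}
    (h₁ : g.IsPath a p b) (h₂ : g.IsPath b q c) : g.IsPath a (p ++ q) c := by
  induction h₁ with
  | nil n => exact h₂
  | cons h _ ih => exact .cons h (ih h₂)

theorem Graph.IsPath.snoc {g : Graph Sg N} {a b c : N} {p : List ℕ} {i : ℕ}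
    (h₁ : g.IsPath a p b) (h₂ : (g.suc b)[i]? = some c) : g.IsPath a (p ++ [i]) c :=
  h₁.append (.cons h₂ (.nil c))

theorem Graph.IsPath.of_snoc {g : Graph Sg N} {a c : N} {p : List ℕ} {i : ℕ}
    (h : g.IsPath a (p ++ [i]) c) : ∃ b, g.IsPath a p b ∧ (g.suc b)[i]? = some c := by
  induction p generalizing a with
  | nil =>
    cases h with
    | cons h₁ h₂ => cases h₂; exact ⟨a, .nil a, h₁⟩
  | cons j p ih =>
    cases h with
    | cons h₁ h₂ =>
      obtain ⟨b, hb, hc⟩ := ih h₂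
      exact ⟨b, .cons h₁ hb, hc⟩

theorem Graph.IsPath.unique {g : Graph Sg N} {a b c : N} {p : List ℕ}
    (h₁ : g.IsPath a p b) (h₂ : g.IsPath a p c) : b = c := by
  induction h₁ with
  | nil n => cases h₂; rfl
  | cons h _ ih =>
    cases h₂ with
    | cons h' h'' =>
      rw [h] at h'
      cases h'
      exact ih h''

theorem Graph.Reach.step {g : Graph Sg N} {a b c : N} (h₁ : g.Reach a b) (h₂ : c ∈ g.suc b) :
    g.Reach a c := by
  obtain ⟨p, hp⟩ := h₁
  obtain ⟨i, hi⟩ := List.mem_iff_getElem?.1 h₂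
  exact ⟨_, hp.snoc hi⟩

theorem getElem?_attachWith_eq {α : Type w} {P : α → Prop} {l : List α} (H : ∀ a ∈ l, P a)
    {i : ℕ} {a : α} (h : l[i]? = some a) (ha : P a) :
    (l.attachWith P H)[i]? = some ⟨a, ha⟩ := by
  have h' : ((l.attachWith P H).map Subtype.val)[i]? = some a := by
    simpa using h
  rw [List.getElem?_map, Option.map_eq_some_iff] at h'
  obtain ⟨b, hb, rfl⟩ := h'
  exact hb

/-- The sub-term graph of `g` rooted in `n`: its nodes are those reachable from `n`. -/
def Graph.sub (g : Graph Sg N) (n : N) : TermGraph Sg {m : N // g.Reach n m} where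
  lab m := g.lab m.1
  suc m := (g.suc m.1).attachWith (g.Reach n) (fun _ hk => m.2.step hk)
  length_suc m := by rw [List.length_attachWith, g.length_suc]
  root := ⟨n, [], .nil n⟩
  reachable := by
    rintro ⟨m, p, hp⟩
    refine ⟨p, ?_⟩
    induction p using List.reverseRecOn generalizing m with
    | nil => cases hp; exact .nil _
    | append_singleton p i ih =>
      obtain ⟨b, hb, hi⟩ := hp.of_snoc
      exact (ih b hb).snoc (getElem?_attachWith_eq _ hi _)

/-- The set of positions of a node of a term graph: all paths from the root to it. -/
def TermGraph.pos (g : TermGraph Sg N) (n : N) : Set (List ℕ) :=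
  {p | g.IsPath g.root p n}

/-- The depth of a node: the least length of its positions (there is at least one position). -/
noncomputable def TermGraph.depth (g : TermGraph Sg N) (n : N) : ℕ :=
  sInf (List.length '' g.pos n)

theorem TermGraph.depth_le {g : TermGraph Sg N} {n : N} {p : List ℕ}
    (h : g.IsPath g.root p n) : g.depth n ≤ p.length :=
  Nat.sInf_le ⟨p, h, rfl⟩

theorem TermGraph.exists_path_depth (g : TermGraph Sg N) (n : N) :
    ∃ p, g.IsPath g.root p n ∧ p.length = g.depth n := by
  obtain ⟨p, hp⟩ := g.reachable n
  exact Nat.sInf_mem (s := List.length '' g.pos n) ⟨_, p, hp, rfl⟩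

theorem TermGraph.depth_suc_le (g : TermGraph Sg N) {n m : N} (h : m ∈ g.suc n) :
    g.depth m ≤ g.depth n + 1 := by
  obtain ⟨p, hp, hl⟩ := g.exists_path_depth n
  obtain ⟨i, hi⟩ := List.mem_iff_getElem?.1 h
  have := TermGraph.depth_le (hp.snoc hi)
  simpa [hl] using this

/-- `Δ`-homomorphisms between term graphs over the same signature: the labelling and successor
conditions are suspended at nodes with a label in `Δ` (a set of constant symbols). -/
structure TermGraph.IsHom {M : Type v} (Δ : Set Sg.Sym) (g : TermGraph Sg N)
    (h : TermGraph Sg M) (φ : N → M) : Prop where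
  map_root : φ g.root = h.root
  map_lab : ∀ n, g.lab n ∉ Δ → g.lab n = h.lab (φ n)
  map_suc : ∀ n, g.lab n ∉ Δ → (g.suc n).map φ = h.suc (φ n)

/-- Isomorphism of term graphs: a bijective homomorphism. -/
def TermGraph.Iso {M : Type v} (g : TermGraph Sg N) (h : TermGraph Sg M) : Prop :=
  ∃ φ : N ≃ M, g.IsHom ∅ h φ

/-! ### Canonical term graphs -/

/-- A canonical term graph over `Sg`: every node is the set of its positions. -/
structure CTermGraph (Sg : Signature.{u}) where
  nodes : Set (Set (List ℕ))
  graph : TermGraph Sg nodes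
  canonical : ∀ n : nodes, n.1 = graph.pos n

theorem TermGraph.pos_injective (g : TermGraph Sg N) : Function.Injective g.pos := by
  intro a b h
  obtain ⟨p, hp⟩ := g.reachable a
  have hb : p ∈ g.pos b := h ▸ (show p ∈ g.pos a from hp)
  exact Graph.IsPath.unique hp hb

/-- The correspondence between the nodes of a term graph and their sets of positions. -/
noncomputable def TermGraph.posEquiv (g : TermGraph Sg N) : N ≃ Set.range g.pos :=
  Equiv.ofInjective g.pos g.pos_injective

/-- The graph obtained by renaming the nodes along a bijection. -/
def Graph.rename {M : Type v} (g : Graph Sg N) (e : N ≃ M) : Graph Sg M where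
  lab m := g.lab (e.symm m)
  suc m := (g.suc (e.symm m)).map e
  length_suc m := by rw [List.length_map, g.length_suc]

theorem Graph.IsPath.rename {M : Type v} {g : Graph Sg N} (e : N ≃ M) {a b : N} {p : List ℕ}
    (h : g.IsPath a p b) : (g.rename e).IsPath (e a) p (e b) := by
  induction h with
  | nil n => exact .nil _
  | cons h _ ih => exact .cons (by simp [Graph.rename, h]) ih

theorem Graph.IsPath.of_rename {M : Type v} {g : Graph Sg N} (e : N ≃ M) {a b : M}
    {p : List ℕ} (h : (g.rename e).IsPath a p b) : g.IsPath (e.symm a) p (e.symm b) := by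
  induction h with
  | nil n => exact .nil _
  | cons h _ ih =>
    simp only [Graph.rename, List.getElem?_map, Option.map_eq_some_iff] at h
    obtain ⟨c, hc, rfl⟩ := h
    rw [e.symm_apply_apply] at ih
    exact .cons hc ih

/-- The canonical representative of `g`: every node is replaced by the set of its positions. -/
noncomputable def TermGraph.canon (g : TermGraph Sg N) : CTermGraph Sg where
  nodes := Set.range g.pos
  graph :=
    { g.toGraph.rename g.posEquiv with
      root := g.posEquiv g.root
      reachable := fun n => by
        obtain ⟨p, hp⟩ := g.reachable (g.posEquiv.symm n)
        refine ⟨p, ?_⟩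
        have := hp.rename g.posEquiv
        rwa [Equiv.apply_symm_apply] at this }
  canonical := by
    intro n
    obtain ⟨m, rfl⟩ := g.posEquiv.surjective n
    ext p
    constructor
    · intro hp
      exact Graph.IsPath.rename g.posEquiv (show g.IsPath g.root p m from hp)
    · intro hp
      have := Graph.IsPath.of_rename g.posEquiv hp
      rw [Equiv.symm_apply_apply, Equiv.symm_apply_apply] at this
      exact this

/-! ### Partial term graphs: partial order, truncations, simple distance -/

/-- A partial term graph is total if it does not contain the symbol `⊥`; total canonical term
graphs over `Σ_⊥` are the canonical term graphs over `Σ`. -/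
def CTermGraph.IsTotal (g : CTermGraph Sg.withBot) : Prop :=
  ∀ n, g.graph.lab n ≠ none

/-- The simple partial order: `g ≤ h` iff there is a `⊥`-homomorphism from `g` to `h`. -/
instance instLECTermGraph : LE (CTermGraph Sg.withBot) where
  le g h := ∃ φ : g.nodes → h.nodes, g.graph.IsHom ({none} : Set (Option Sg.Sym)) h.graph φ

open Classical in
/-- The simple truncation of `g` at depth `d`. -/
noncomputable def TermGraph.trunc (g : TermGraph Sg.withBot N) (d : ℕ) :
    TermGraph Sg.withBot {n : N // g.depth n ≤ d} where
  lab n := if g.depth n.1 < d then g.lab n.1 else none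
  suc n :=
    if h : g.depth n.1 < d then
      (g.suc n.1).attachWith (fun m => g.depth m ≤ d)
        (fun _ hm => (g.depth_suc_le hm).trans h)
    else []
  length_suc n := by
    by_cases h : g.depth n.1 < d
    · simp only [h, if_true, dif_pos]
      rw [List.length_attachWith, g.length_suc]
    · simp [h]
  root := ⟨g.root, (TermGraph.depth_le (.nil _)).trans (Nat.zero_le d)⟩
  reachable := by
    rintro ⟨n, hn⟩
    obtain ⟨p, hp, hl⟩ := g.exists_path_depth n
    have hpd : p.length ≤ d := hl ▸ hn
    clear hl
    refine ⟨p, ?_⟩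
    induction p using List.reverseRecOn generalizing n with
    | nil => cases hp; exact .nil _
    | append_singleton p i ih =>
      obtain ⟨b, hb, hi⟩ := hp.of_snoc
      rw [List.length_append, List.length_singleton] at hpd
      have hbd : g.depth b < d := (TermGraph.depth_le hb).trans_lt hpd
      refine (ih b hbd.le hb (by omega)).snoc ?_
      simp only [hbd, dif_pos]
      exact getElem?_attachWith_eq _ hi _

open Classical in
/-- The simple distance: `0` if `g = h`, and `2 ^ (-d)` otherwise, where `d` is the largest depth
such that the truncations of `g` and `h` at `d` are isomorphic. -/
noncomputable def CTermGraph.sdist (g h : CTermGraph Sg.withBot) : ℝ :=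
  if g = h then 0
  else ((2 : ℝ) ^ sSup {e : ℕ | (g.graph.trunc e).Iso (h.graph.trunc e)})⁻¹

open Classical in
/-- Label the node `n` with `⊥` and remove all its outgoing edges. -/
noncomputable def Graph.cut (g : Graph Sg.withBot N) (n : N) : Graph Sg.withBot N where
  lab m := if m = n then none else g.lab m
  suc m := if m = n then [] else g.suc m
  length_suc m := by
    by_cases h : m = n
    · simp [h]
    · simp only [h, if_false]
      exact g.length_suc m

/-- The local truncation of `g` at `n`: label `n` with `⊥`, remove its outgoing edges, and
remove all nodes that become unreachable from the root. -/
noncomputable def TermGraph.ltrunc (g : TermGraph Sg.withBot N) (n : N) :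
    TermGraph Sg.withBot {m : N // (g.toGraph.cut n).Reach g.root m} :=
  (g.toGraph.cut n).sub g.root

end Basic

/-! ### Term graph rewriting systems -/

/-- A term graph rule over `Sg` with variables in `V`: a graph over `Σ_V` all of whose nodes are
reachable from `l` or `r`, in which every variable labels at most one node, this node is not `l`,
and it is reachable from `l`. -/
structure Rule (Sg : Signature.{u}) (V : Type v) where
  N : Type x
  graph : Graph (Sg.withVars V) N
  l : N
  r : N
  reachable : ∀ n, graph.Reach l n ∨ graph.Reach r n
  var_unique : ∀ a n m, graph.lab n = Sum.inr a → graph.lab m = Sum.inr a → n = m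
  var_ne : ∀ a n, graph.lab n = Sum.inr a → n ≠ l
  var_reach : ∀ a n, graph.lab n = Sum.inr a → graph.Reach l n

/-- A term graph rewriting system over `Sg`: a set of term graph rules over `Sg`. -/
abbrev GRS (Sg : Signature.{u}) (V : Type v) := Set (Rule.{u, v, x} Sg V)

section Rewriting

variable {Sg : Signature.{u}} {V : Type v} {N : Type w}

theorem Graph.mapSym_isPath {Sg' : Signature.{y}} (g : Graph Sg N) (f : Sg.Sym → Sg'.Sym)
    (hf : ∀ s, Sg'.ar (f s) = Sg.ar s) {a b : N} {p : List ℕ} (h : g.IsPath a p b) :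
    (g.mapSym f hf).IsPath a p b := by
  induction h with
  | nil n => exact .nil _
  | cons h _ ih => exact .cons h ih

theorem Graph.mapSym_reach {Sg' : Signature.{y}} (g : Graph Sg N) (f : Sg.Sym → Sg'.Sym)
    (hf : ∀ s, Sg'.ar (f s) = Sg.ar s) {a b : N} (h : g.Reach a b) :
    (g.mapSym f hf).Reach a b :=
  ⟨h.choose, g.mapSym_isPath f hf h.choose_spec⟩

/-- A term graph over `Σ`, read as a term graph over `Σ_V`. -/
def TermGraph.withVars (g : TermGraph Sg N) (V : Type v) : TermGraph (Sg.withVars V) N where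
  toGraph := g.toGraph.mapSym Sum.inl (fun _ => rfl)
  root := g.root
  reachable n := g.toGraph.mapSym_reach _ _ (g.reachable n)

theorem eq_inr_of_map {α : Type u} {β : Type v} {γ : Type w} {f : α → γ} {s : α ⊕ β} {a : β}
    (h : Sum.map f id s = Sum.inr a) : s = Sum.inr a := by
  cases s with
  | inl s => simp at h
  | inr b => simpa using h

/-- A rule over `Σ`, read as a rule over `Σ_⊥`. -/
def Rule.withBot (ρ : Rule.{u, v, x} Sg V) : Rule.{u, v, x} Sg.withBot V where
  N := ρ.N
  graph := ρ.graph.mapSym (Sum.map some id) (by rintro (s | a) <;> rfl)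
  l := ρ.l
  r := ρ.r
  reachable n := (ρ.reachable n).imp (Graph.mapSym_reach _ _ _) (Graph.mapSym_reach _ _ _)
  var_unique a n m hn hm := by
    exact ρ.var_unique a n m (eq_inr_of_map hn) (eq_inr_of_map hm)
  var_ne a n hn := by
    exact ρ.var_ne a n (eq_inr_of_map hn)
  var_reach a n hn := by
    exact Graph.mapSym_reach _ _ _ (ρ.var_reach a n (eq_inr_of_map hn))

/-- The system `R_⊥ = (Σ_⊥, R)`. -/
def GRS.withBot (R : GRS.{u, v, x} Sg V) : GRS.{u, v, x} Sg.withBot V :=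
  Rule.withBot '' R

/-- The nodes of the left-hand side of a rule. -/
abbrev Rule.LNode (ρ : Rule.{u, v, x} Sg V) : Type x := {m : ρ.N // ρ.graph.Reach ρ.l m}

/-- The nodes of a rule that are not in its left-hand side. -/
abbrev Rule.NewNode (ρ : Rule.{u, v, x} Sg V) : Type x := {m : ρ.N // ¬ ρ.graph.Reach ρ.l m}

theorem Rule.isLeft_lab (ρ : Rule.{u, v, x} Sg V) (m : ρ.NewNode) :
    (ρ.graph.lab m.1).isLeft = true := by
  cases h : ρ.graph.lab m.1 with
  | inl s => rfl
  | inr a => exact absurd (ρ.var_reach a m.1 h) m.2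

/-- `φ` matches the left-hand side of `ρ` against the sub-term graph of `g` rooted in `n`: it is a
`V`-homomorphism from the former to the latter. -/
def TermGraph.IsMatch (g : TermGraph Sg N) (n : N) (ρ : Rule.{u, v, x} Sg V)
    (φ : ρ.LNode → {m : N // g.toGraph.Reach n m}) : Prop :=
  (ρ.graph.sub ρ.l).IsHom (Set.range Sum.inr) ((g.toGraph.sub n).withVars V) φ

open Classical in
/-- Where a node of the rule goes to when `ρ` is copied into `g`: nodes of the left-hand side are
sent to their image under `φ`, the other ones to their copy. -/
noncomputable def Rule.place (ρ : Rule.{u, v, x} Sg V) (φ : ρ.LNode → N) (m : ρ.N) :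
    N ⊕ ρ.NewNode :=
  if h : ρ.graph.Reach ρ.l m then Sum.inl (φ ⟨m, h⟩) else Sum.inr ⟨m, h⟩

/-- The graph `g` together with copies of all nodes and edges of `ρ` that are not in its left-hand
side, where edges pointing to a node `m` of the left-hand side are redirected to `φ m`. -/
noncomputable def Graph.build (g : Graph Sg N) (ρ : Rule.{u, v, x} Sg V) (φ : ρ.LNode → N) :
    Graph Sg (N ⊕ ρ.NewNode) where
  lab := Sum.elim g.lab (fun m => (ρ.graph.lab m.1).getLeft (ρ.isLeft_lab m))
  suc := Sum.elim (fun n => (g.suc n).map Sum.inl)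
    (fun m => (ρ.graph.suc m.1).map (ρ.place φ))
  length_suc := by
    rintro (n | m)
    · simp only [Sum.elim_inl, List.length_map, g.length_suc]
    · simp only [Sum.elim_inr, List.length_map, ρ.graph.length_suc]
      conv_lhs => rw [← Sum.inl_getLeft (ρ.graph.lab m.1) (ρ.isLeft_lab m)]
      rfl

/-- The graph `g` with all edges redirected: an edge to `m` becomes an edge to `f m`. -/
def Graph.redirect (g : Graph Sg N) (f : N → N) : Graph Sg N where
  lab := g.lab
  suc n := (g.suc n).map f
  length_suc n := by rw [List.length_map, g.length_suc]

open Classical in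
/-- The redirection of the redex root `n` to the root of the contractum (the place of `r`). -/
noncomputable def Rule.redir (ρ : Rule.{u, v, x} Sg V) (φ : ρ.LNode → N) (n : N)
    (k : N ⊕ ρ.NewNode) : N ⊕ ρ.NewNode :=
  if k = Sum.inl n then ρ.place φ ρ.r else k

/-- The graph obtained from `g` by copying the rule and then redirecting all edges that point to
the root `n` of the redex to the root of the contractum. -/
noncomputable def Graph.rewrite (g : Graph Sg N) (n : N) (ρ : Rule.{u, v, x} Sg V)
    (φ : ρ.LNode → N) : Graph Sg (N ⊕ ρ.NewNode) :=
  (g.build ρ φ).redirect (ρ.redir φ n)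

/-- The result of the pre-reduction step that contracts the redex of `ρ` rooted in `n` with
matching `φ`: the rewritten graph without the nodes that are not reachable from its root. If `n` is
the root of `g`, then the new root is the root of the contractum. -/
noncomputable def TermGraph.contract (g : TermGraph Sg N) (n : N) (ρ : Rule.{u, v, x} Sg V)
    (φ : ρ.LNode → N) : TermGraph Sg {k : N ⊕ ρ.NewNode //
      (g.toGraph.rewrite n ρ φ).Reach (ρ.redir φ n (Sum.inl g.root)) k} :=
  (g.toGraph.rewrite n ρ φ).sub (ρ.redir φ n (Sum.inl g.root))

/-- `IsStep R g n h`: the triple `(g, n, h)` is a reduction step in `R`, i.e. it is obtained from a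
pre-reduction step by passing to canonical representatives. (All term graphs are countable, so it
is no restriction that the term graph `g'` has its nodes in `Type`.) -/
def IsStep (R : GRS.{u, v, x} Sg V) (g : CTermGraph Sg) (n : g.nodes) (h : CTermGraph Sg) : Prop :=
  ∃ ρ ∈ R, ∃ (N' : Type) (g' : TermGraph Sg N') (n' : N')
    (φ : ρ.LNode → {m : N' // g'.toGraph.Reach n' m}),
    g'.IsMatch n' ρ φ ∧ g'.canon = g ∧ n.1 = g'.pos n' ∧
      (g'.contract n' ρ (fun m => (φ m).1)).canon = h

/-- A reduction `(g_ι →[n_ι] g_{ι+1})_{ι < α}` of ordinal length `α`. The values of `graph` beyond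
the underlying sequence of term graphs and of `node` from `α` on carry no meaning and are never
used. -/
structure Reduction (R : GRS.{u, v, x} Sg V) where
  len : Ordinal.{y}
  graph : Ordinal.{y} → CTermGraph Sg
  node : ∀ ι, (graph ι).nodes
  step : ∀ ι < len, IsStep R (graph ι) (node ι) (graph (Order.succ ι))

/-- A reduction is open if its length is a limit ordinal, and closed otherwise (the length is zero
or a successor). -/
def Reduction.IsOpen {R : GRS.{u, v, x} Sg V} (S : Reduction.{u, v, x, y} R) : Prop :=
  Order.IsSuccLimit S.len

open Classical in
/-- The length of the underlying sequence of term graphs of a reduction of length `α`: it is `α` if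
the reduction is open, and `α + 1` if it is closed. -/
noncomputable def Reduction.seqLen {R : GRS.{u, v, x} Sg V} (S : Reduction.{u, v, x, y} R) :
    Ordinal.{y} :=
  if S.IsOpen then S.len else Order.succ S.len

/-! ### Convergence -/

/-- `f ι` converges to `g` with respect to the simple distance, as `ι` tends to `l`. -/
def IsSLim (f : Ordinal.{y} → CTermGraph Sg.withBot) (l : Ordinal.{y})
    (g : CTermGraph Sg.withBot) : Prop :=
  ∀ ε > 0, ∃ β < l, ∀ ι, β ≤ ι → ι < l → (f ι).sdist g < ε

/-- `g` is the limit inferior of `f ι` with respect to the simple partial order, as `ι` tends to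
`l`: the least upper bound over `β < l` of the greatest lower bounds of the `f ι`, `β ≤ ι < l`. -/
def IsSLiminf (f : Ordinal.{y} → CTermGraph Sg.withBot) (l : Ordinal.{y})
    (g : CTermGraph Sg.withBot) : Prop :=
  ∃ b : Ordinal.{y} → CTermGraph Sg.withBot,
    (∀ β < l, IsGLB {c | ∃ ι, β ≤ ι ∧ ι < l ∧ c = f ι} (b β)) ∧
      IsLUB {c | ∃ β < l, c = b β} g

/-- `f ι` tends to infinity as `ι` tends to `l`. -/
def TendsToInfty (f : Ordinal.{y} → ℕ) (l : Ordinal.{y}) : Prop :=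
  ∀ d, ∃ β < l, ∀ ι, β ≤ ι → ι < l → d ≤ f ι

namespace Reduction

variable {R : GRS.{u, v, x} Sg.withBot V} (S : Reduction.{u, v, x, y} R)

/-- All term graphs in `S` are total. -/
def IsTotal : Prop := ∀ ι < S.seqLen, (S.graph ι).IsTotal

/-- The depth of the redex of the `ι`-th step. -/
noncomputable def redexDepth (ι : Ordinal.{y}) : ℕ := (S.graph ι).graph.depth (S.node ι)

/-- The reduction context of the `ι`-th step. -/
noncomputable def context (ι : Ordinal.{y}) : CTermGraph Sg.withBot :=
  ((S.graph ι).graph.ltrunc (S.node ι)).canon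

/-- Strong `m`-continuity. -/
def StronglyMContinuous : Prop :=
  ∀ l < S.len, Order.IsSuccLimit l →
    IsSLim S.graph l (S.graph l) ∧ TendsToInfty S.redexDepth l

/-- Strong `m`-convergence of `S` from `g` to `h` in the metric space of total canonical term
graphs. -/
def StronglyMConverges (g h : CTermGraph Sg.withBot) : Prop :=
  S.graph 0 = g ∧ S.IsTotal ∧ h.IsTotal ∧ S.StronglyMContinuous ∧
    ((¬ S.IsOpen ∧ h = S.graph S.len) ∨
      (S.IsOpen ∧ IsSLim S.graph S.len h ∧ TendsToInfty S.redexDepth S.len))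

/-- Strong `p`-continuity. -/
def StronglyPContinuous : Prop :=
  ∀ l < S.len, Order.IsSuccLimit l → IsSLiminf S.context l (S.graph l)

/-- Strong `p`-convergence of `S` from `g` to `h`. -/
def StronglyPConverges (g h : CTermGraph Sg.withBot) : Prop :=
  S.graph 0 = g ∧ S.StronglyPContinuous ∧
    ((¬ S.IsOpen ∧ h = S.graph S.len) ∨ (S.IsOpen ∧ IsSLiminf S.context S.len h))

end Reduction

end Rewriting

end TGR

/-!
A canonical term graph is determined by its positions, by which of them belong to the same node
(`Graph.Shares`) and by their labels (`Graph.LabAt`). In these terms, the truncations of two graphs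
at depth `d` are isomorphic iff the graphs have the same sharing among positions of length at most
`d` and the same labels at positions of length less than `d` (`TermGraph.trunc_iso_iff`), so that
metric convergence is eventual agreement up to every depth (`isSLim_iff`); and `g ≤ h` holds iff `h`
has all the sharing and all the non-`⊥` labels of `g` (`CTermGraph.le_iff`). The latter yields
explicit greatest lower bounds of nonempty sets (`isGLB_meetTree`) and least upper bounds of
directed sets (`unionTree`, `exists_of_isLUB`).

A step at a node `n` and the passage to its reduction context leave the graph unchanged up to every
depth less than that of `n` (`IsStep.agreeTo`, `TermGraph.agreeTo_ltrunc`). If the term graphs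
converge to `G` and the depth of the redexes tends to infinity, then the contexts also agree with
`G` up to ever larger depths, whence their limit inferior is `G`
(`Reduction.isSLiminf_of_isSLim`).

Conversely, let a total `G` be the limit inferior of the contexts. There are only finitely many
positions of length at most `d`, so from some stage on all contexts carry the labels of `G`, none of
them `⊥`, at all of these. As the context of a redex has a `⊥` at the position of the redex, the
redexes are then deeper than `d`, and so the term graphs no longer change up to depth `d`. At limit
stages in between this uses metric convergence there, which is available by induction. Hence the
sharing of short positions is eventually constant; the infima, and with them `G`, inherit exactly
this sharing (`Reduction.isSLim_of_isSLiminf`). This last step is essential, as in the simple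
partial order a total term graph need not be maximal: sharing can still be increased.
-/

namespace TGR

/-! ### Positions -/

section Positions

variable {Sg : Signature.{u}} {N : Type w} {M : Type v}

theorem Graph.isPath_snoc {g : Graph Sg N} {a c : N} {p : List ℕ} {i : ℕ} :
    g.IsPath a (p ++ [i]) c ↔ ∃ b, g.IsPath a p b ∧ (g.suc b)[i]? = some c :=
  ⟨Graph.IsPath.of_snoc, fun ⟨_, h₁, h₂⟩ => h₁.snoc h₂⟩

theorem Graph.isPath_nil {g : Graph Sg N} {a c : N} : g.IsPath a [] c ↔ a = c :=
  ⟨fun h => by cases h; rfl, fun h => h ▸ .nil a⟩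

/-- In `g` with root `a`, the sequences `p` and `q` are positions of the same node. In particular
`g.Shares a p p` says that `p` is a position. -/
def Graph.Shares (g : Graph Sg N) (a : N) (p q : List ℕ) : Prop :=
  ∃ n, g.IsPath a p n ∧ g.IsPath a q n

/-- In `g` with root `a`, the sequence `p` is a position of a node labelled `s`. -/
def Graph.LabAt (g : Graph Sg N) (a : N) (p : List ℕ) (s : Sg.Sym) : Prop :=
  ∃ n, g.IsPath a p n ∧ g.lab n = s

variable {g : Graph Sg N} {a : N} {p q r : List ℕ} {s t : Sg.Sym} {i d : ℕ}

theorem Graph.Shares.symm (h : g.Shares a p q) : g.Shares a q p :=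
  h.imp fun _ h => h.symm

theorem Graph.Shares.trans (h₁ : g.Shares a p q) (h₂ : g.Shares a q r) : g.Shares a p r := by
  obtain ⟨n, hp, hq⟩ := h₁
  obtain ⟨m, hq', hr⟩ := h₂
  obtain rfl := hq.unique hq'
  exact ⟨n, hp, hr⟩

theorem Graph.Shares.left (h : g.Shares a p q) : g.Shares a p p :=
  h.trans h.symm

theorem Graph.Shares.right (h : g.Shares a p q) : g.Shares a q q :=
  h.symm.left

theorem Graph.shares_nil (g : Graph Sg N) (a : N) : g.Shares a [] [] :=
  ⟨a, .nil a, .nil a⟩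

theorem Graph.LabAt.shares (h : g.LabAt a p s) : g.Shares a p p :=
  h.imp fun _ h => ⟨h.1, h.1⟩

theorem Graph.LabAt.unique (h₁ : g.LabAt a p s) (h₂ : g.LabAt a p t) : s = t := by
  obtain ⟨n, hp, rfl⟩ := h₁
  obtain ⟨m, hp', rfl⟩ := h₂
  rw [hp.unique hp']

theorem Graph.Shares.exists_labAt (h : g.Shares a p q) : ∃ s, g.LabAt a p s := by
  obtain ⟨n, hp, -⟩ := h
  exact ⟨_, n, hp, rfl⟩

theorem Graph.LabAt.of_shares (h₁ : g.LabAt a p s) (h₂ : g.Shares a p q) : g.LabAt a q s := by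
  obtain ⟨n, hp, rfl⟩ := h₁
  obtain ⟨m, hp', hq⟩ := h₂
  obtain rfl := hp.unique hp'
  exact ⟨n, hq, rfl⟩

theorem Graph.LabAt.shares_snoc (h₁ : g.LabAt a p s) (h₂ : g.Shares a p q) (hi : i < Sg.ar s) :
    g.Shares a (p ++ [i]) (q ++ [i]) := by
  obtain ⟨n, hp, rfl⟩ := h₁
  obtain ⟨m, hp', hq⟩ := h₂
  obtain rfl := hp.unique hp'
  rw [← g.length_suc] at hi
  have := List.getElem?_eq_getElem hi
  exact ⟨_, hp.snoc this, hq.snoc this⟩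

theorem Graph.Shares.of_snoc (h : g.Shares a (p ++ [i]) q) :
    ∃ s, g.LabAt a p s ∧ i < Sg.ar s := by
  obtain ⟨n, hp, -⟩ := h
  obtain ⟨b, hb, hi⟩ := hp.of_snoc
  refine ⟨_, ⟨b, hb, rfl⟩, ?_⟩
  rw [← g.length_suc]
  exact (List.getElem?_eq_some_iff.1 hi).1

theorem Graph.Shares.of_append (h : g.Shares a (p ++ r) q) : g.Shares a p p := by
  induction r using List.reverseRecOn generalizing q with
  | nil => rw [List.append_nil] at h; exact h.left
  | append_singleton r i ih =>
    rw [← List.append_assoc] at h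
    obtain ⟨s, hs, -⟩ := h.of_snoc
    exact ih hs.shares

/-- There are only finitely many positions of bounded length, as all arities are finite. -/
theorem Graph.finite_positions (g : Graph Sg N) (a : N) (d : ℕ) :
    {p | p.length ≤ d ∧ g.Shares a p p}.Finite := by
  induction d with
  | zero =>
    refine (Set.finite_singleton []).subset ?_
    rintro p ⟨hp, -⟩
    simpa using hp
  | succ d ih =>
    have key : ∀ p, Set.Finite {q | (∃ i, q = p ++ [i]) ∧ g.Shares a q q} := by
      intro p
      by_cases hp : ∃ s, g.LabAt a p s
      · obtain ⟨s, hs⟩ := hp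
        refine ((Set.finite_lt_nat (Sg.ar s)).image (fun i => p ++ [i])).subset ?_
        rintro _ ⟨⟨i, rfl⟩, hq⟩
        obtain ⟨t, ht, hi⟩ := hq.of_snoc
        exact ⟨i, ht.unique hs ▸ hi, rfl⟩
      · refine Set.finite_empty.subset ?_
        rintro _ ⟨⟨i, rfl⟩, hq⟩
        obtain ⟨t, ht, hi⟩ := hq.of_snoc
        exact hp ⟨t, ht⟩
    refine ((Set.finite_singleton []).union (ih.biUnion fun p _ => key p)).subset ?_
    rintro p ⟨hp, hs⟩
    induction p using List.reverseRecOn with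
    | nil => exact Or.inl rfl
    | append_singleton p i _ =>
      rw [List.length_append, List.length_singleton] at hp
      refine Or.inr (Set.mem_biUnion (x := p) ⟨by omega, ?_⟩ ⟨⟨i, rfl⟩, hs⟩)
      exact hs.of_append

/-! ### Agreement up to a depth -/

/-- The rooted graphs `(g, a)` and `(h, b)` agree up to depth `d`: they have the same sharing among
positions of length at most `d` and the same labels at positions of length less than `d`. This is
the description of isomorphism of the simple truncations at `d` in terms of positions. -/
structure Graph.AgreeTo (d : ℕ) (g : Graph Sg N) (a : N) (h : Graph Sg M) (b : M) : Prop where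
  shares : ∀ p q, p.length ≤ d → q.length ≤ d → (g.Shares a p q ↔ h.Shares b p q)
  labAt : ∀ p s, p.length < d → (g.LabAt a p s ↔ h.LabAt b p s)

theorem Graph.AgreeTo.refl (d : ℕ) (g : Graph Sg N) (a : N) : g.AgreeTo d a g a :=
  ⟨fun _ _ _ _ => Iff.rfl, fun _ _ _ => Iff.rfl⟩

theorem Graph.AgreeTo.symm {h : Graph Sg M} {b : M} (H : g.AgreeTo d a h b) :
    h.AgreeTo d b g a :=
  ⟨fun p q hp hq => (H.shares p q hp hq).symm, fun p s hp => (H.labAt p s hp).symm⟩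

theorem Graph.AgreeTo.trans {h : Graph Sg M} {b : M} {M' : Type y} {k : Graph Sg M'} {c : M'}
    (H : g.AgreeTo d a h b) (H' : h.AgreeTo d b k c) : g.AgreeTo d a k c :=
  ⟨fun p q hp hq => (H.shares p q hp hq).trans (H'.shares p q hp hq),
    fun p s hp => (H.labAt p s hp).trans (H'.labAt p s hp)⟩

theorem Graph.AgreeTo.mono {h : Graph Sg M} {b : M} {e : ℕ} (H : g.AgreeTo d a h b)
    (he : e ≤ d) : g.AgreeTo e a h b :=
  ⟨fun p q hp hq => H.shares p q (hp.trans he) (hq.trans he),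
    fun p s hp => H.labAt p s (hp.trans_le he)⟩

/-- An injective map that preserves the root, and preserves labels and successors at all nodes that
have a position of length less than `d`, induces a correspondence of all positions of length at
most `d`. -/
theorem Graph.isPath_iff_of_map {h : Graph Sg M} {b : M} (f : N → M)
    (hroot : f a = b)
    (H : ∀ p n, p.length < d → g.IsPath a p n → h.IsPath b p (f n) →
      h.suc (f n) = (g.suc n).map f) {p : List ℕ} (hp : p.length ≤ d) {m : M} :
    h.IsPath b p m ↔ ∃ n, g.IsPath a p n ∧ f n = m := by
  induction p using List.reverseRecOn generalizing m with
  | nil => simp [Graph.isPath_nil, hroot]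
  | append_singleton p i ih =>
    rw [List.length_append, List.length_singleton] at hp
    simp only [Graph.isPath_snoc]
    constructor
    · rintro ⟨c, hc, hi⟩
      obtain ⟨n, hn, rfl⟩ := (ih (by omega)).1 hc
      rw [H p n hp hn hc, List.getElem?_map, Option.map_eq_some_iff] at hi
      obtain ⟨k, hk, rfl⟩ := hi
      exact ⟨k, ⟨n, hn, hk⟩, rfl⟩
    · rintro ⟨k, ⟨n, hn, hk⟩, rfl⟩
      have hc := (ih (m := f n) (by omega)).2 ⟨n, hn, rfl⟩
      refine ⟨f n, hc, ?_⟩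
      rw [H p n hp hn hc, List.getElem?_map, hk]
      rfl

theorem Graph.AgreeTo.of_map {h : Graph Sg M} {b : M} (f : N → M) (hf : Function.Injective f)
    (hroot : f a = b)
    (H : ∀ p n, p.length < d → g.IsPath a p n → h.IsPath b p (f n) →
      h.lab (f n) = g.lab n ∧ h.suc (f n) = (g.suc n).map f) : g.AgreeTo d a h b := by
  have key : ∀ p : List ℕ, p.length ≤ d → ∀ m,
      (h.IsPath b p m ↔ ∃ n, g.IsPath a p n ∧ f n = m) := fun p hp m =>
    Graph.isPath_iff_of_map f hroot (fun p n hp hg hh => (H p n hp hg hh).2) hp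
  constructor
  · intro p q hp hq
    constructor
    · rintro ⟨n, hn, hn'⟩
      exact ⟨f n, (key p hp _).2 ⟨n, hn, rfl⟩, (key q hq _).2 ⟨n, hn', rfl⟩⟩
    · rintro ⟨m, hm, hm'⟩
      obtain ⟨n, hn, rfl⟩ := (key p hp _).1 hm
      obtain ⟨n', hn', he⟩ := (key q hq _).1 hm'
      obtain rfl := hf he
      exact ⟨_, hn, hn'⟩
  · intro p s hp
    constructor
    · rintro ⟨n, hn, rfl⟩
      have := (key p hp.le _).2 ⟨n, hn, rfl⟩
      exact ⟨f n, this, (H p n hp hn this).1⟩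
    · rintro ⟨m, hm, rfl⟩
      obtain ⟨n, hn, rfl⟩ := (key p hp.le _).1 hm
      exact ⟨n, hn, (H p n hp hn hm).1.symm⟩

theorem Graph.sub_agreeTo (g : Graph Sg N) (a : N) (d : ℕ) :
    (g.sub a).toGraph.AgreeTo d (g.sub a).root g a := by
  refine .of_map Subtype.val Subtype.val_injective rfl fun p n _ _ _ => ⟨rfl, ?_⟩
  simp [Graph.sub]

theorem TermGraph.agreeTo_canon (g : TermGraph Sg N) (d : ℕ) :
    g.toGraph.AgreeTo d g.root g.canon.graph.toGraph g.canon.graph.root := by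
  refine .of_map g.posEquiv g.posEquiv.injective rfl fun p n _ _ _ => ?_
  simp [TermGraph.canon, Graph.rename]

/-- Cutting a node does not affect the graph up to the depth of this node. -/
theorem TermGraph.agreeTo_cut (g : TermGraph Sg.withBot N) (n : N) (hd : d ≤ g.depth n) :
    g.toGraph.AgreeTo d g.root (g.toGraph.cut n) g.root := by
  refine .of_map id Function.injective_id rfl fun p m hp hm _ => ?_
  have hne : m ≠ n := by
    rintro rfl
    have := TermGraph.depth_le hm
    omega
  simp [Graph.cut, hne]

theorem TermGraph.agreeTo_ltrunc (g : TermGraph Sg.withBot N) (n : N) (hd : d ≤ g.depth n) :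
    g.toGraph.AgreeTo d g.root (g.ltrunc n).canon.graph.toGraph (g.ltrunc n).canon.graph.root :=
  (g.agreeTo_cut n hd).trans <|
    ((g.toGraph.cut n).sub_agreeTo g.root d).symm.trans ((g.ltrunc n).agreeTo_canon d)

/-- The cut node is labelled `⊥` in the local truncation, where it keeps its shortest positions. -/
theorem TermGraph.exists_labAt_ltrunc (g : TermGraph Sg.withBot N) (n : N) :
    ∃ p, p.length = g.depth n ∧
      (g.ltrunc n).canon.graph.LabAt (g.ltrunc n).canon.graph.root p none := by
  obtain ⟨p, hp, hl⟩ := g.exists_path_depth n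
  refine ⟨p, hl, ?_⟩
  have H : (g.toGraph.cut n).LabAt g.root p none := by
    refine ⟨n, ?_, by simp [Graph.cut]⟩
    refine (Graph.isPath_iff_of_map (d := g.depth n) (g := g.toGraph) (a := g.root) id rfl
      (fun q m hq hm _ => ?_) hl.le).2 ⟨n, hp, rfl⟩
    have hne : m ≠ n := by
      rintro rfl
      have := TermGraph.depth_le hm
      omega
    simp [Graph.cut, hne]
  rw [← ((g.ltrunc n).agreeTo_canon (p.length + 1)).labAt p _ (Nat.lt_succ_self _)]
  exact (((g.toGraph.cut n).sub_agreeTo g.root (p.length + 1)).labAt p _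
    (Nat.lt_succ_self _)).2 H

end Positions

/-- A reduction step at a node of depth greater than `d` changes nothing up to depth `d`: the edges
that are redirected start in nodes of depth at least `d`. -/
theorem IsStep.agreeTo {Sg : Signature.{u}} {V : Type v} {R : GRS.{u, v, x} Sg V}
    {g h : CTermGraph Sg} {n : g.nodes} (H : IsStep R g n h) {d : ℕ}
    (hd : d < g.graph.depth n) :
    g.graph.toGraph.AgreeTo d g.graph.root h.graph.toGraph h.graph.root := by
  obtain ⟨ρ, -, N', g', n', φ, -, rfl, hn, rfl⟩ := H
  have hdep : g'.canon.graph.depth n = g'.depth n' := by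
    unfold TermGraph.depth
    rw [← g'.canon.canonical n, hn]
  rw [hdep] at hd
  refine (g'.agreeTo_canon d).symm.trans (.trans ?_ (TermGraph.agreeTo_canon _ d))
  refine .trans ?_ (Graph.sub_agreeTo _ _ d).symm
  have hne : ∀ {p m}, g'.IsPath g'.root p m → p.length ≤ d → m ≠ n' := by
    rintro p m hm hp rfl
    have := TermGraph.depth_le hm
    omega
  refine .of_map Sum.inl Sum.inl_injective ?_ fun p m hp hm _ => ⟨rfl, ?_⟩
  · have : g'.root ≠ n' := hne (.nil _) (Nat.zero_le d)
    simp [Rule.redir, this]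
  · simp only [Graph.rewrite, Graph.redirect, Graph.build, Sum.elim_inl, List.map_map]
    refine List.map_congr_left fun k hk => ?_
    obtain ⟨i, hi⟩ := List.mem_iff_getElem?.1 hk
    have : k ≠ n' := hne (hm.snoc hi) (by simpa using hp)
    simp [Rule.redir, this]

section Truncation

variable {Sg : Signature.{u}} {N : Type w} {M : Type v}

/-! ### Truncations and the simple distance -/

theorem TermGraph.trunc_agreeTo (g : TermGraph Sg.withBot N) (d : ℕ) :
    (g.trunc d).toGraph.AgreeTo d (g.trunc d).root g.toGraph g.root := by
  refine .of_map Subtype.val Subtype.val_injective rfl fun p n hp _ hn => ?_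
  have : g.depth n.1 < d := (TermGraph.depth_le hn).trans_lt hp
  simp [TermGraph.trunc, this]

theorem TermGraph.IsHom.isPath {g : TermGraph Sg N} {h : TermGraph Sg M} {φ : N → M}
    {Δ : Set Sg.Sym} (hΔ : ∀ s ∈ Δ, Sg.ar s = 0) (H : g.IsHom Δ h φ) {p : List ℕ} {n m : N}
    (hp : g.IsPath n p m) : h.IsPath (φ n) p (φ m) := by
  induction hp with
  | nil n => exact .nil _
  | @cons n m k i p hi _ ih =>
    refine .cons ?_ ih
    have hn : g.lab n ∉ Δ := by
      intro hn
      have h0 := g.length_suc n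
      rw [hΔ _ hn, List.length_eq_zero_iff] at h0
      simp [h0] at hi
    rw [← H.map_suc n hn, List.getElem?_map, hi]
    rfl

theorem TermGraph.Iso.agreeTo {g : TermGraph Sg N} {h : TermGraph Sg M} (H : g.Iso h) (d : ℕ) :
    g.toGraph.AgreeTo d g.root h.toGraph h.root := by
  obtain ⟨φ, hφ⟩ := H
  exact .of_map φ φ.injective hφ.map_root fun p n _ _ _ =>
    ⟨(hφ.map_lab n (Set.notMem_empty _)).symm, (hφ.map_suc n (Set.notMem_empty _)).symm⟩

/-- If `g` and `h` agree up to depth `d`, then every node of `g` of depth at most `d` has a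
counterpart in `h`: a node with the same positions of length at most `d`. -/
theorem Graph.AgreeTo.exists_counterpart {g : TermGraph Sg N} {h : TermGraph Sg M} {d : ℕ}
    (H : g.toGraph.AgreeTo d g.root h.toGraph h.root) (n : N) (hn : g.depth n ≤ d) :
    ∃ m, h.depth m = g.depth n ∧
      ∀ p : List ℕ, p.length ≤ d → (g.IsPath g.root p n ↔ h.IsPath h.root p m) := by
  obtain ⟨p, hp, hl⟩ := g.exists_path_depth n
  obtain ⟨m, hm, -⟩ := (H.shares p p (by omega) (by omega)).1 ⟨n, hp, hp⟩
  have key : ∀ q : List ℕ, q.length ≤ d → (g.IsPath g.root q n ↔ h.IsPath h.root q m) := by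
    intro q hq
    constructor
    · intro hqn
      obtain ⟨m', h₁, h₂⟩ := (H.shares p q (by omega) hq).1 ⟨n, hp, hqn⟩
      rwa [hm.unique h₁]
    · intro hqm
      obtain ⟨n', h₁, h₂⟩ := (H.shares p q (by omega) hq).2 ⟨m, hm, hqm⟩
      rwa [hp.unique h₁]
  refine ⟨m, le_antisymm (hl ▸ TermGraph.depth_le hm) ?_, key⟩
  obtain ⟨q, hq, hql⟩ := h.exists_path_depth m
  have := TermGraph.depth_le hm
  rw [← hql]
  exact TermGraph.depth_le ((key q (by omega)).2 hq)

theorem Graph.AgreeTo.trunc_iso {g : TermGraph Sg.withBot N} {h : TermGraph Sg.withBot M} {d : ℕ}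
    (H : g.toGraph.AgreeTo d g.root h.toGraph h.root) : (g.trunc d).Iso (h.trunc d) := by
  choose φ hdep hφ using fun n : {n : N // g.depth n ≤ d} => H.exists_counterpart n.1 n.2
  have hmem : ∀ n, h.depth (φ n) ≤ d := fun n => (hdep n).trans_le n.2
  let ψ : {n : N // g.depth n ≤ d} → {m : M // h.depth m ≤ d} := fun n => ⟨φ n, hmem n⟩
  have uniq : ∀ (p : List ℕ) n m, p.length ≤ d → g.IsPath g.root p n.1 →
      h.IsPath h.root p m → φ n = m := fun p n m hp hn hm => ((hφ n p hp).1 hn).unique hm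
  have bij : Function.Bijective ψ := by
    constructor
    · intro n n' he
      have he : φ n = φ n' := congrArg Subtype.val he
      obtain ⟨p, hp, hl⟩ := g.exists_path_depth n.1
      have hpd : p.length ≤ d := hl.trans_le n.2
      have := (hφ n p hpd).1 hp
      rw [he] at this
      exact Subtype.ext (hp.unique ((hφ n' p hpd).2 this))
    · rintro ⟨m, hm⟩
      obtain ⟨n, hn, hnm⟩ := H.symm.exists_counterpart m hm
      obtain ⟨p, hp, hl⟩ := h.exists_path_depth m
      refine ⟨⟨n, hn.trans_le hm⟩, Subtype.ext ?_⟩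
      have hpd : p.length ≤ d := by omega
      exact uniq p _ m hpd ((hnm p hpd).1 hp) hp
  have hlab : ∀ n : {n : N // g.depth n ≤ d}, g.depth n.1 < d → g.lab n.1 = h.lab (φ n) := by
    intro n hn
    obtain ⟨p, hp, hl⟩ := g.exists_path_depth n.1
    obtain ⟨m, hm, hml⟩ := (H.labAt p _ (by omega)).1 ⟨n.1, hp, rfl⟩
    rw [uniq p n m (by omega) hp hm, hml]
  refine ⟨Equiv.ofBijective ψ bij, ⟨?_, fun n _ => ?_, fun n _ => ?_⟩⟩
  · exact Subtype.ext (uniq [] _ _ (Nat.zero_le d) (.nil _) (.nil _))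
  · by_cases hn : g.depth n.1 < d
    · simpa [TermGraph.trunc, ψ, hdep, hn] using hlab n hn
    · simp [TermGraph.trunc, ψ, hdep, hn]
  · by_cases hn : g.depth n.1 < d
    · obtain ⟨p, hp, hl⟩ := g.exists_path_depth n.1
      have hm : h.IsPath h.root p (φ n) := (hφ n p (by omega)).1 hp
      have hlen : (g.suc n.1).length = (h.suc (φ n)).length := by
        rw [g.length_suc, h.length_suc, hlab n hn]
      -- the inclusions of the truncations reduce the claim to one about `g` and `h`
      apply List.map_injective_iff.2 Subtype.val_injective
      apply List.ext_getElem?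
      intro i
      simp only [TermGraph.trunc, hn, ψ, hdep, dif_pos, Equiv.ofBijective_apply,
        List.getElem?_map]
      by_cases hi : i < (g.suc n.1).length
      · have hg := List.getElem?_eq_getElem hi
        have hh := List.getElem?_eq_getElem (hlen ▸ hi)
        have hk := (g.depth_suc_le (List.getElem_mem hi)).trans hn
        rw [getElem?_attachWith_eq _ hg hk,
          getElem?_attachWith_eq _ hh ((h.depth_suc_le (List.getElem_mem _)).trans
            ((hdep n).trans_lt hn))]
        simp only [Option.map_some, Option.some.injEq]
        exact uniq (p ++ [i]) _ _ (by simp; omega) (hp.snoc hg) (hm.snoc hh)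
      · have hi' : ¬ i < (h.suc (φ n)).length := hlen ▸ hi
        rw [List.getElem?_eq_none (by simpa using hi), List.getElem?_eq_none (by simpa using hi')]
        rfl
    · simp [TermGraph.trunc, ψ, hdep, hn]

theorem TermGraph.trunc_iso_iff {g : TermGraph Sg.withBot N} {h : TermGraph Sg.withBot M}
    {d : ℕ} : (g.trunc d).Iso (h.trunc d) ↔ g.toGraph.AgreeTo d g.root h.toGraph h.root :=
  ⟨fun H => (g.trunc_agreeTo d).symm.trans ((H.agreeTo d).trans (h.trunc_agreeTo d)),
    fun H => H.trunc_iso⟩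

/-- In the graph `g`, the sequences `p` and `q` are positions of the same node. -/
abbrev CTermGraph.Shares (g : CTermGraph Sg) : List ℕ → List ℕ → Prop :=
  g.graph.Shares g.graph.root

/-- In the graph `g`, the sequence `p` is a position of a node labelled `s`. -/
abbrev CTermGraph.LabAt (g : CTermGraph Sg) : List ℕ → Sg.Sym → Prop :=
  g.graph.LabAt g.graph.root

/-- The canonical term graphs `g` and `h` agree up to depth `d`. -/
abbrev CTermGraph.AgreeTo (d : ℕ) (g h : CTermGraph Sg) : Prop :=
  g.graph.toGraph.AgreeTo d g.graph.root h.graph.toGraph h.graph.root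

/-- A canonical term graph is determined by its positions, their sharing and their labels. -/
theorem CTermGraph.eq_of_agreeTo {g h : CTermGraph Sg} (H : ∀ d, g.AgreeTo d h) : g = h := by
  have hs : ∀ p q, g.Shares p q ↔ h.Shares p q := fun p q =>
    (H (max p.length q.length)).shares p q (le_max_left _ _) (le_max_right _ _)
  have hl : ∀ p s, g.LabAt p s ↔ h.LabAt p s := fun p s =>
    (H (p.length + 1)).labAt p s (Nat.lt_succ_self _)
  have sub : ∀ {g h : CTermGraph Sg}, (∀ p q, g.Shares p q ↔ h.Shares p q) →
      g.nodes ⊆ h.nodes := by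
    intro g h hs s hsg
    obtain ⟨p, hp⟩ := g.graph.reachable ⟨s, hsg⟩
    obtain ⟨m, hm, -⟩ := (hs p p).1 ⟨_, hp, hp⟩
    have : s = m.1 := by
      refine (g.canonical ⟨s, hsg⟩).trans (.trans ?_ (h.canonical m).symm)
      ext q
      constructor
      · intro hq
        obtain ⟨m', h₁, h₂⟩ := (hs p q).1 ⟨_, hp, hq⟩
        rwa [← hm.unique h₁] at h₂
      · intro hq
        obtain ⟨n', h₁, h₂⟩ := (hs p q).2 ⟨_, hm, hq⟩
        rwa [← hp.unique h₁] at h₂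
    exact this ▸ m.2
  have hnodes := (sub hs).antisymm (sub fun p q => (hs p q).symm)
  obtain ⟨A, ⟨⟨lab, suc, hlen⟩, root, hreach⟩, hcan⟩ := g
  obtain ⟨B, ⟨⟨lab', suc', hlen'⟩, root', hreach'⟩, hcan'⟩ := h
  obtain rfl : A = B := hnodes
  set G : Graph Sg A := ⟨lab, suc, hlen⟩
  set G' : Graph Sg A := ⟨lab', suc', hlen'⟩
  have hG : ∀ p n, G.IsPath root p n ↔ p ∈ n.1 := fun p n =>
    ⟨fun hp => by rw [hcan n]; exact hp, fun hp => by rw [hcan n] at hp; exact hp⟩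
  have hG' : ∀ p n, G'.IsPath root' p n ↔ p ∈ n.1 := fun p n =>
    ⟨fun hp => by rw [hcan' n]; exact hp, fun hp => by rw [hcan' n] at hp; exact hp⟩
  have hlab : lab = lab' := by
    funext n
    obtain ⟨p, hp⟩ := hreach n
    obtain ⟨m, hm, hml⟩ := (hl p (lab n)).1 ⟨n, hp, rfl⟩
    have : n = m := Graph.IsPath.unique ((hG' p n).2 ((hG p n).1 hp)) hm
    subst this
    exact hml.symm
  have hsuc : suc = suc' := by
    funext n
    obtain ⟨p, hp⟩ := hreach n
    have hp' : G'.IsPath root' p n := (hG' p n).2 ((hG p n).1 hp)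
    refine List.ext_getElem? fun i => Option.ext fun m => ?_
    have e₁ : (suc n)[i]? = some m ↔ G.IsPath root (p ++ [i]) m := by
      refine ⟨fun h => hp.snoc h, fun h => ?_⟩
      obtain ⟨b, hb, hi⟩ := h.of_snoc
      rwa [← Graph.IsPath.unique hp hb] at hi
    have e₂ : (suc' n)[i]? = some m ↔ G'.IsPath root' (p ++ [i]) m := by
      refine ⟨fun h => hp'.snoc h, fun h => ?_⟩
      obtain ⟨b, hb, hi⟩ := h.of_snoc
      rwa [← Graph.IsPath.unique hp' hb] at hi
    rw [e₁, e₂, hG, hG']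
  have hroot : root = root' := by
    have := (hG' [] root).2 ((hG [] root).1 (.nil _))
    exact (Graph.isPath_nil.1 this).symm
  subst hlab hsuc hroot
  rfl

variable {g h : CTermGraph Sg.withBot}

/-- The set defining the simple distance is bounded, so that its supremum is a maximum. -/
theorem CTermGraph.bddAbove_trunc_iso (hne : g ≠ h) :
    BddAbove {e : ℕ | (g.graph.trunc e).Iso (h.graph.trunc e)} := by
  by_contra hb
  refine hne (CTermGraph.eq_of_agreeTo fun d => ?_)
  rw [not_bddAbove_iff] at hb
  obtain ⟨e, he, hde⟩ := hb d
  exact (TermGraph.trunc_iso_iff.1 he).mono hde.le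

theorem CTermGraph.AgreeTo.sdist_le {d : ℕ} (H : g.AgreeTo d h) : g.sdist h ≤ (2 ^ d)⁻¹ := by
  unfold CTermGraph.sdist
  split_ifs with he
  · positivity
  · have := le_csSup (CTermGraph.bddAbove_trunc_iso he) (TermGraph.trunc_iso_iff.2 H)
    gcongr
    norm_num

theorem CTermGraph.agreeTo_of_sdist_lt {d : ℕ} (H : g.sdist h < (2 ^ d)⁻¹) : g.AgreeTo d h := by
  unfold CTermGraph.sdist at H
  split_ifs at H with he
  · exact he ▸ Graph.AgreeTo.refl _ _ _
  · have h0 : (0 : ℕ) ∈ {e : ℕ | (g.graph.trunc e).Iso (h.graph.trunc e)} := by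
      refine TermGraph.trunc_iso_iff.2 ⟨fun p q hp hq => ?_, fun p s hp => absurd hp (by simp)⟩
      obtain rfl : p = [] := by simpa using hp
      obtain rfl : q = [] := by simpa using hq
      exact iff_of_true (Graph.shares_nil _ _) (Graph.shares_nil _ _)
    have hmem := Nat.sSup_mem ⟨0, h0⟩ (CTermGraph.bddAbove_trunc_iso he)
    refine (TermGraph.trunc_iso_iff.1 hmem).mono ?_
    rw [inv_lt_inv₀ (by positivity) (by positivity)] at H
    exact ((pow_lt_pow_iff_right₀ one_lt_two).1 H).le

theorem isSLim_iff {f : Ordinal.{y} → CTermGraph Sg.withBot} {l : Ordinal.{y}} :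
    IsSLim f l g ↔ ∀ d, ∃ β < l, ∀ ι, β ≤ ι → ι < l → (f ι).AgreeTo d g := by
  constructor
  · intro H d
    obtain ⟨β, hβ, Hβ⟩ := H (2 ^ d)⁻¹ (by positivity)
    exact ⟨β, hβ, fun ι h₁ h₂ => CTermGraph.agreeTo_of_sdist_lt (Hβ ι h₁ h₂)⟩
  · intro H ε hε
    obtain ⟨d, hd⟩ := exists_pow_lt_of_lt_one hε (show (2 : ℝ)⁻¹ < 1 by norm_num)
    obtain ⟨β, hβ, Hβ⟩ := H d
    refine ⟨β, hβ, fun ι h₁ h₂ => (Hβ ι h₁ h₂).sdist_le.trans_lt ?_⟩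
    rwa [← inv_pow]

/-! ### The simple partial order -/

/-- The simple partial order in terms of positions. -/
theorem CTermGraph.le_iff : g ≤ h ↔ (∀ p q, g.Shares p q → h.Shares p q) ∧
    ∀ p f, g.LabAt p (some f) → h.LabAt p (some f) := by
  constructor
  · rintro ⟨φ, hφ⟩
    have hpath : ∀ {p n}, g.graph.IsPath g.graph.root p n →
        h.graph.IsPath h.graph.root p (φ n) := fun hp =>
      hφ.map_root ▸ hφ.isPath (by rintro _ rfl; rfl) hp
    refine ⟨fun p q ⟨n, hp, hq⟩ => ⟨φ n, hpath hp, hpath hq⟩, fun p f ⟨n, hp, hn⟩ =>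
      ⟨φ n, hpath hp, ?_⟩⟩
    rw [← hφ.map_lab n (by simp [hn]), hn]
  · rintro ⟨hs, hl⟩
    have key : ∀ n : g.nodes, ∃ m : h.nodes, ∀ p, g.graph.IsPath g.graph.root p n →
        h.graph.IsPath h.graph.root p m := by
      intro n
      obtain ⟨p, hp⟩ := g.graph.reachable n
      obtain ⟨m, hm, -⟩ := hs p p ⟨n, hp, hp⟩
      refine ⟨m, fun q hq => ?_⟩
      obtain ⟨m', h₁, h₂⟩ := hs p q ⟨n, hp, hq⟩
      rwa [hm.unique h₁]
    choose φ hφ using key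
    have hlab : ∀ n, g.graph.lab n ∉ ({none} : Set (Option Sg.Sym)) →
        g.graph.lab n = h.graph.lab (φ n) := by
      intro n hn
      obtain ⟨f, hf⟩ := Option.ne_none_iff_exists'.1 hn
      obtain ⟨p, hp⟩ := g.graph.reachable n
      obtain ⟨m, hm, hml⟩ := hl p f ⟨n, hp, hf⟩
      rw [(hφ n p hp).unique hm, hf, hml]
    refine ⟨φ, Graph.isPath_nil.1 (hφ _ [] (.nil _)) ▸ rfl, hlab, fun n hn => ?_⟩
    obtain ⟨p, hp⟩ := g.graph.reachable n
    refine List.ext_getElem ?_ fun i h₁ h₂ => ?_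
    · rw [List.length_map, g.graph.length_suc, h.graph.length_suc, hlab n hn]
    · rw [List.getElem_map]
      rw [List.length_map] at h₁
      exact (hφ _ _ (hp.snoc (List.getElem?_eq_getElem h₁))).unique
        ((hφ n p hp).snoc (List.getElem?_eq_getElem h₂))

/-- A labelled quotient tree: the data of a canonical partial term graph in terms of positions.
The relation `rel` says that two sequences are positions of the same node, so `rel p p` says that
`p` is a position, and `lab p f` says that `p` has the label `f`; positions without such a label
carry `⊥`. -/
structure QuotTree (Sg : Signature.{u}) where
  rel : List ℕ → List ℕ → Prop
  lab : List ℕ → Sg.Sym → Prop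
  symm : ∀ {p q}, rel p q → rel q p
  trans : ∀ {p q r}, rel p q → rel q r → rel p r
  lab_unique : ∀ {p f f'}, lab p f → lab p f' → f = f'
  lab_rel : ∀ {p q f}, rel p q → lab p f → lab q f
  nil : rel [] []
  of_snoc : ∀ {p i}, rel (p ++ [i]) (p ++ [i]) → rel p p ∧ ∃ f, lab p f ∧ i < Sg.ar f
  snoc : ∀ {p q f i}, rel p q → lab p f → i < Sg.ar f → rel (p ++ [i]) (q ++ [i])

namespace QuotTree

variable (t : QuotTree Sg)

open Classical in
/-- The label of a sequence, as a symbol in `Σ_⊥`. -/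
noncomputable def symb (p : List ℕ) : Sg.withBot.Sym :=
  if h : ∃ f, t.lab p f then some h.choose else none

theorem symb_eq_some {p : List ℕ} {f : Sg.Sym} : t.symb p = some f ↔ t.lab p f := by
  unfold symb
  split_ifs with h
  · rw [Option.some.injEq]
    exact ⟨fun e => e ▸ h.choose_spec, fun hf => t.lab_unique h.choose_spec hf⟩
  · exact ⟨fun e => by simp at e, fun hf => absurd ⟨f, hf⟩ h⟩

theorem lt_ar_symb {p : List ℕ} {i : ℕ} :
    i < Sg.withBot.ar (t.symb p) ↔ ∃ f, t.lab p f ∧ i < Sg.ar f := by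
  cases h : t.symb p with
  | none =>
    refine iff_of_false (Nat.not_lt_zero i) ?_
    rintro ⟨f, hf, -⟩
    rw [t.symb_eq_some.2 hf] at h
    cases h
  | some f =>
    have hf := t.symb_eq_some.1 h
    exact ⟨fun hi => ⟨f, hf, hi⟩, fun ⟨f', hf', hi⟩ => t.lab_unique hf hf' ▸ hi⟩

/-- The nodes of the canonical term graph: the equivalence classes of positions. -/
def nodes : Set (Set (List ℕ)) := {s | ∃ p, t.rel p p ∧ s = {q | t.rel p q}}

/-- The class of a position. -/
def cls (p : List ℕ) (hp : t.rel p p) : t.nodes := ⟨{q | t.rel p q}, p, hp, rfl⟩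

/-- A chosen position of a node. -/
noncomputable def rep (n : t.nodes) : List ℕ := n.2.choose

theorem rel_rep (n : t.nodes) : t.rel (t.rep n) (t.rep n) := n.2.choose_spec.1

theorem mem_iff {n : t.nodes} {p : List ℕ} : p ∈ n.1 ↔ t.rel (t.rep n) p :=
  iff_of_eq (congrArg (p ∈ ·) n.2.choose_spec.2)

theorem cls_eq_iff {n : t.nodes} {p : List ℕ} (hp : t.rel p p) : t.cls p hp = n ↔ p ∈ n.1 := by
  constructor
  · rintro rfl; exact hp
  · intro h
    rw [mem_iff] at h
    refine Subtype.ext (Set.ext fun q => ?_)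
    exact .trans ⟨t.trans h, t.trans (t.symm h)⟩ t.mem_iff.symm

/-- The graph of a labelled quotient tree. -/
noncomputable def toGraph : Graph Sg.withBot t.nodes where
  lab n := t.symb (t.rep n)
  suc n := List.ofFn fun i : Fin (Sg.withBot.ar (t.symb (t.rep n))) =>
    t.cls (t.rep n ++ [i.1]) (by
      obtain ⟨f, hf, hi⟩ := t.lt_ar_symb.1 i.2
      exact t.snoc (t.rel_rep n) hf hi)
  length_suc _ := List.length_ofFn

theorem suc_getElem? {n m : t.nodes} {i : ℕ} :
    (t.toGraph.suc n)[i]? = some m ↔ t.rep n ++ [i] ∈ m.1 := by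
  have hlen : (t.toGraph.suc n).length = Sg.withBot.ar (t.symb (t.rep n)) := t.toGraph.length_suc n
  rw [List.getElem?_eq_some_iff]
  constructor
  · rintro ⟨hi, e⟩
    obtain ⟨f, hf, hif⟩ := t.lt_ar_symb.1 (hlen ▸ hi)
    rw [← t.cls_eq_iff (t.snoc (t.rel_rep n) hf hif), ← e]
    simp only [toGraph, List.getElem_ofFn]
  · intro h
    have hr := t.mem_iff.1 h
    have hi := t.of_snoc (t.trans (t.symm hr) hr)
    refine ⟨hlen ▸ t.lt_ar_symb.2 hi.2, ?_⟩
    simp only [toGraph, List.getElem_ofFn]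
    rwa [cls_eq_iff]

theorem isPath_iff {p : List ℕ} {n : t.nodes} :
    t.toGraph.IsPath (t.cls [] t.nil) p n ↔ p ∈ n.1 := by
  induction p using List.reverseRecOn generalizing n with
  | nil => rw [Graph.isPath_nil, cls_eq_iff]
  | append_singleton p i ih =>
    simp only [Graph.isPath_snoc, ih, suc_getElem?]
    constructor
    · rintro ⟨b, hb, hi⟩
      rw [mem_iff] at hb hi ⊢
      obtain ⟨-, f, hf, hf'⟩ := t.of_snoc (t.trans (t.symm hi) hi)
      exact t.trans hi (t.snoc hb hf hf')
    · intro h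
      rw [mem_iff] at h
      obtain ⟨hp, f, hf, hi⟩ := t.of_snoc (t.trans (t.symm h) h)
      refine ⟨t.cls p hp, hp, ?_⟩
      have hr : t.rel p (t.rep (t.cls p hp)) := 
        t.symm (t.mem_iff.1 (show p ∈ (t.cls p hp).1 from hp))
      rw [mem_iff]
      exact t.trans h (t.snoc hr hf hi)

/-- The canonical term graph of a labelled quotient tree. -/
noncomputable def toCTermGraph : CTermGraph Sg.withBot where
  nodes := t.nodes
  graph :=
    { t.toGraph with
      root := t.cls [] t.nil
      reachable := fun n => ⟨t.rep n, t.isPath_iff.2 (t.mem_iff.2 (t.rel_rep n))⟩ }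
  canonical _ := Set.ext fun _ => t.isPath_iff.symm

theorem shares_iff {p q : List ℕ} : t.toCTermGraph.Shares p q ↔ t.rel p q := by
  constructor
  · rintro ⟨n, hp, hq⟩
    have hp := t.mem_iff.1 (t.isPath_iff.1 hp)
    have hq := t.mem_iff.1 (t.isPath_iff.1 hq)
    exact t.trans (t.symm hp) hq
  · intro h
    exact ⟨t.cls p (t.trans h (t.symm h)), t.isPath_iff.2 (t.trans h (t.symm h)),
      t.isPath_iff.2 h⟩

theorem labAt_iff {p : List ℕ} {f : Sg.Sym} :
    t.toCTermGraph.LabAt p (some f) ↔ t.rel p p ∧ t.lab p f := by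
  constructor
  · rintro ⟨n, hp, hn⟩
    have hp := t.mem_iff.1 (t.isPath_iff.1 hp)
    exact ⟨t.trans (t.symm hp) hp, t.lab_rel hp (t.symb_eq_some.1 hn)⟩
  · rintro ⟨hp, hf⟩
    refine ⟨t.cls p hp, t.isPath_iff.2 hp, ?_⟩
    exact t.symb_eq_some.2 (t.lab_rel (t.symm (t.mem_iff.1 (show p ∈ (t.cls p hp).1 from hp))) hf)

end QuotTree

/-! ### Greatest lower bounds and directed unions -/

/-- All proper prefixes of `p` are positions that carry a symbol other than `⊥`, the same
one in all term graphs in `C`. -/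
def CommonPrefixes (C : Set (CTermGraph Sg.withBot)) (p : List ℕ) : Prop :=
  ∀ q i, q ++ [i] <+: p → ∃ f : Sg.Sym, ∀ g ∈ C, g.LabAt q (some f)

theorem commonPrefixes_snoc {C : Set (CTermGraph Sg.withBot)} {p : List ℕ} {i : ℕ} :
    CommonPrefixes C (p ++ [i]) ↔
      CommonPrefixes C p ∧ ∃ f : Sg.Sym, ∀ g ∈ C, g.LabAt p (some f) := by
  constructor
  · intro h
    exact ⟨fun q j hq => h q j (hq.trans (List.prefix_append _ _)), h p i List.prefix_rfl⟩
  · rintro ⟨h₁, h₂⟩ q j hq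
    rcases List.prefix_concat_iff.1 hq with e | hq
    · obtain ⟨rfl, -⟩ := List.append_inj' e rfl
      exact h₂
    · exact h₁ q j hq

/-- Since `⊥` is a constant, a position that can be extended carries a symbol other than `⊥`. -/
theorem CTermGraph.exists_labAt_of_snoc {g : CTermGraph Sg.withBot} {p q : List ℕ} {i : ℕ}
    (h : g.Shares (p ++ [i]) q) : ∃ f, g.LabAt p (some f) ∧ i < Sg.ar f := by
  obtain ⟨_ | f, hf, hi⟩ := Graph.Shares.of_snoc h
  · exact absurd hi (Nat.not_lt_zero i)
  · exact ⟨f, hf, hi⟩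

/-- The greatest lower bound of a nonempty set of term graphs, as a labelled quotient tree: two
positions are shared if they are shared in all of the graphs and are cut off nowhere above. -/
def meetTree (C : Set (CTermGraph Sg.withBot)) (hC : C.Nonempty) : QuotTree Sg where
  rel p q := (∀ g ∈ C, g.Shares p q) ∧ CommonPrefixes C p ∧ CommonPrefixes C q
  lab p f := ∀ g ∈ C, g.LabAt p (some f)
  symm h := ⟨fun g hg => (h.1 g hg).symm, h.2.2, h.2.1⟩
  trans h h' := ⟨fun g hg => (h.1 g hg).trans (h'.1 g hg), h.2.1, h'.2.2⟩
  lab_unique h h' := by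
    obtain ⟨g, hg⟩ := hC
    exact Option.some.inj ((h g hg).unique (h' g hg))
  lab_rel h hl g hg := (hl g hg).of_shares (h.1 g hg)
  nil := ⟨fun g _ => Graph.shares_nil _ _, fun q i h => absurd (List.prefix_nil.1 h) (by simp),
    fun q i h => absurd (List.prefix_nil.1 h) (by simp)⟩
  of_snoc := by
    rintro p i ⟨hs, hc, -⟩
    obtain ⟨hc, f, hf⟩ := commonPrefixes_snoc.1 hc
    obtain ⟨g, hg⟩ := hC
    obtain ⟨f', hf', hi⟩ := CTermGraph.exists_labAt_of_snoc (hs g hg)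
    obtain rfl := Option.some.inj ((hf g hg).unique hf')
    exact ⟨⟨fun k hk => (hf k hk).shares, hc, hc⟩, f, hf, hi⟩
  snoc := by
    rintro p q f i ⟨hs, hp, hq⟩ hf hi
    exact ⟨fun g hg => (hf g hg).shares_snoc (hs g hg) hi, commonPrefixes_snoc.2 ⟨hp, f, hf⟩,
      commonPrefixes_snoc.2 ⟨hq, f, fun g hg => (hf g hg).of_shares (hs g hg)⟩⟩

theorem isGLB_meetTree (C : Set (CTermGraph Sg.withBot)) (hC : C.Nonempty) :
    IsGLB C (meetTree C hC).toCTermGraph := by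
  constructor
  · intro g hg
    refine CTermGraph.le_iff.2 ⟨fun p q h => ?_, fun p f h => ?_⟩
    · exact ((QuotTree.shares_iff _).1 h).1 g hg
    · exact ((QuotTree.labAt_iff _).1 h).2 g hg
  · intro k hk
    have hs : ∀ g ∈ C, ∀ p q, k.Shares p q → g.Shares p q := fun g hg =>
      (CTermGraph.le_iff.1 (hk hg)).1
    have hl : ∀ g ∈ C, ∀ p f, k.LabAt p (some f) → g.LabAt p (some f) := fun g hg =>
      (CTermGraph.le_iff.1 (hk hg)).2
    have hc : ∀ p, k.Shares p p → CommonPrefixes C p := by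
      rintro p hp q i ⟨r, rfl⟩
      obtain ⟨f, hf, -⟩ := CTermGraph.exists_labAt_of_snoc hp.of_append
      exact ⟨f, fun g hg => hl g hg q f hf⟩
    refine CTermGraph.le_iff.2 ⟨fun p q h => ?_, fun p f h => ?_⟩
    · exact (QuotTree.shares_iff _).2 ⟨fun g hg => hs g hg p q h, hc p h.left, hc q h.right⟩
    · exact (QuotTree.labAt_iff _).2
        ⟨⟨fun g hg => hs g hg p p h.shares, hc p h.shares, hc p h.shares⟩, fun g hg =>
          hl g hg p f h⟩

/-- The least upper bound of a nonempty directed set of term graphs, as a labelled quotient tree: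
the union of the sharing and of the labels. -/
def unionTree (B : Set (CTermGraph Sg.withBot)) (hB : B.Nonempty)
    (hdir : ∀ g ∈ B, ∀ h ∈ B, ∃ k ∈ B, g ≤ k ∧ h ≤ k) : QuotTree Sg where
  rel p q := ∃ g ∈ B, g.Shares p q
  lab p f := ∃ g ∈ B, g.LabAt p (some f)
  symm := fun ⟨g, hg, h⟩ => ⟨g, hg, h.symm⟩
  trans := by
    rintro p q r ⟨g, hg, h⟩ ⟨g', hg', h'⟩
    obtain ⟨k, hk, hgk, hgk'⟩ := hdir g hg g' hg'
    exact ⟨k, hk, ((CTermGraph.le_iff.1 hgk).1 _ _ h).trans ((CTermGraph.le_iff.1 hgk').1 _ _ h')⟩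
  lab_unique := by
    rintro p f f' ⟨g, hg, h⟩ ⟨g', hg', h'⟩
    obtain ⟨k, hk, hgk, hgk'⟩ := hdir g hg g' hg'
    exact Option.some.inj
      (((CTermGraph.le_iff.1 hgk).2 _ _ h).unique ((CTermGraph.le_iff.1 hgk').2 _ _ h'))
  lab_rel := by
    rintro p q f ⟨g, hg, h⟩ ⟨g', hg', h'⟩
    obtain ⟨k, hk, hgk, hgk'⟩ := hdir g hg g' hg'
    exact ⟨k, hk, ((CTermGraph.le_iff.1 hgk').2 _ _ h').of_shares
      ((CTermGraph.le_iff.1 hgk).1 _ _ h)⟩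
  nil := hB.imp fun g hg => ⟨hg, Graph.shares_nil _ _⟩
  of_snoc := by
    rintro p i ⟨g, hg, h⟩
    obtain ⟨f, hf, hi⟩ := CTermGraph.exists_labAt_of_snoc h
    exact ⟨⟨g, hg, hf.shares⟩, f, ⟨g, hg, hf⟩, hi⟩
  snoc := by
    rintro p q f i ⟨g, hg, h⟩ ⟨g', hg', h'⟩ hi
    obtain ⟨k, hk, hgk, hgk'⟩ := hdir g hg g' hg'
    exact ⟨k, hk, ((CTermGraph.le_iff.1 hgk').2 _ _ h').shares_snoc
      ((CTermGraph.le_iff.1 hgk).1 _ _ h) hi⟩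

/-- All sharing and all symbols other than `⊥` in the least upper bound of a directed set stem from
members of this set. -/
theorem exists_of_isLUB {B : Set (CTermGraph Sg.withBot)} (hB : B.Nonempty)
    (hdir : ∀ g ∈ B, ∀ h ∈ B, ∃ k ∈ B, g ≤ k ∧ h ≤ k) {u : CTermGraph Sg.withBot}
    (hu : IsLUB B u) : (∀ p q, u.Shares p q → ∃ g ∈ B, g.Shares p q) ∧
      ∀ p f, u.LabAt p (some f) → ∃ g ∈ B, g.LabAt p (some f) := by
  have hle : u ≤ (unionTree B hB hdir).toCTermGraph := by
    refine hu.2 fun g hg => CTermGraph.le_iff.2 ⟨fun p q h => ?_, fun p f h => ?_⟩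
    · exact (QuotTree.shares_iff _).2 ⟨g, hg, h⟩
    · exact (QuotTree.labAt_iff _).2 ⟨⟨g, hg, h.shares⟩, g, hg, h⟩
  obtain ⟨hs, hl⟩ := CTermGraph.le_iff.1 hle
  exact ⟨fun p q h => (QuotTree.shares_iff _).1 (hs p q h), fun p f h =>
    ((QuotTree.labAt_iff _).1 (hl p f h)).2⟩

end Truncation

/-! ### Convergence at a limit ordinal -/

section Convergence

variable {Sg : Signature.{u}} {V : Type v} {R : GRS.{u, v, x} Sg.withBot V}

/-- The reduction contexts from stage `β` on, below `l`. -/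
def Reduction.contextsFrom (S : Reduction.{u, v, x, y} R) (l β : Ordinal.{y}) :
    Set (CTermGraph Sg.withBot) :=
  {c | ∃ ι, β ≤ ι ∧ ι < l ∧ c = S.context ι}

theorem Reduction.contextsFrom_nonempty (S : Reduction.{u, v, x, y} R) {l β : Ordinal.{y}}
    (hβ : β < l) : (S.contextsFrom l β).Nonempty :=
  ⟨_, β, le_rfl, hβ, rfl⟩

theorem Reduction.agreeTo_context (S : Reduction.{u, v, x, y} R) {ι : Ordinal.{y}} {d : ℕ}
    (hd : d ≤ S.redexDepth ι) : (S.context ι).AgreeTo d (S.graph ι) :=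
  (TermGraph.agreeTo_ltrunc _ _ hd).symm

theorem Reduction.agreeTo_succ (S : Reduction.{u, v, x, y} R) {ι : Ordinal.{y}} {d : ℕ}
    (hι : ι < S.len) (hd : d < S.redexDepth ι) :
    (S.graph ι).AgreeTo d (S.graph (Order.succ ι)) :=
  (S.step ι hι).agreeTo hd

theorem CTermGraph.IsTotal.exists_labAt {g : CTermGraph Sg.withBot} (hg : g.IsTotal)
    {p q : List ℕ} (h : g.Shares p q) : ∃ f, g.LabAt p (some f) := by
  obtain ⟨n, hp, -⟩ := h
  obtain ⟨f, hf⟩ := Option.ne_none_iff_exists'.1 (hg n)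
  exact ⟨f, n, hp, hf⟩

/-- If `G` is the limit of the term graphs and the depth of the redexes tends to infinity, then the
reduction contexts agree with `G` up to ever larger depths and `G` is their limit inferior: the
greatest lower bounds of final segments contain ever larger parts of `G`. -/
theorem Reduction.isSLiminf_of_isSLim (S : Reduction.{u, v, x, y} R) {l : Ordinal.{y}}
    {G : CTermGraph Sg.withBot} (hlim : IsSLim S.graph l G)
    (hdepth : TendsToInfty S.redexDepth l) : IsSLiminf S.context l G := by
  classical
  have hctx : ∀ d, ∃ β < l, ∀ ι, β ≤ ι → ι < l → (S.context ι).AgreeTo d G := by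
    intro d
    obtain ⟨β₁, h₁, H₁⟩ := isSLim_iff.1 hlim d
    obtain ⟨β₂, h₂, H₂⟩ := hdepth d
    refine ⟨max β₁ β₂, max_lt h₁ h₂, fun ι hι hιl => ?_⟩
    exact (S.agreeTo_context (H₂ ι ((le_max_right _ _).trans hι) hιl)).trans
      (H₁ ι ((le_max_left _ _).trans hι) hιl)
  let b : Ordinal.{y} → CTermGraph Sg.withBot := fun β =>
    if h : β < l then (meetTree _ (S.contextsFrom_nonempty h)).toCTermGraph else G
  have hb : ∀ β (h : β < l), b β = (meetTree _ (S.contextsFrom_nonempty h)).toCTermGraph :=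
    fun β h => dif_pos h
  have hglb : ∀ β < l, IsGLB (S.contextsFrom l β) (b β) := fun β h => by
    rw [hb β h]
    exact isGLB_meetTree _ _
  refine ⟨b, hglb, ?_, ?_⟩
  · rintro _ ⟨β, hβ, rfl⟩
    have hle : ∀ d, ∃ c : CTermGraph Sg.withBot, b β ≤ c ∧ c.AgreeTo d G := by
      intro d
      obtain ⟨γ, hγ, H⟩ := hctx d
      exact ⟨S.context (max β γ), (hglb β hβ).1 ⟨_, le_max_left _ _, max_lt hβ hγ, rfl⟩,
        H _ (le_max_right _ _) (max_lt hβ hγ)⟩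
    refine CTermGraph.le_iff.2 ⟨fun p q h => ?_, fun p f h => ?_⟩
    · obtain ⟨c, hc, hcG⟩ := hle (max p.length q.length)
      exact (hcG.shares p q (le_max_left _ _) (le_max_right _ _)).1
        ((CTermGraph.le_iff.1 hc).1 p q h)
    · obtain ⟨c, hc, hcG⟩ := hle (p.length + 1)
      exact (hcG.labAt p _ (Nat.lt_succ_self _)).1 ((CTermGraph.le_iff.1 hc).2 p f h)
  · intro k hk
    have hmeet : ∀ β (h : β < l), (meetTree _ (S.contextsFrom_nonempty h)).toCTermGraph ≤ k :=
      fun β h => hb β h ▸ hk ⟨β, h, rfl⟩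
    have hpre : ∀ d β, (∀ ι, β ≤ ι → ι < l → (S.context ι).AgreeTo d G) →
        ∀ p : List ℕ, p.length ≤ d → G.Shares p p →
          CommonPrefixes (S.contextsFrom l β) p := by
      rintro d β H p hp hs q i ⟨r, rfl⟩
      obtain ⟨f, hf, -⟩ := CTermGraph.exists_labAt_of_snoc hs.of_append
      refine ⟨f, ?_⟩
      rintro _ ⟨ι, h₁, h₂, rfl⟩
      refine ((H ι h₁ h₂).labAt q _ ?_).2 hf
      simp only [List.length_append, List.length_singleton] at hp
      omega
    refine CTermGraph.le_iff.2 ⟨fun p q h => ?_, fun p f h => ?_⟩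
    · obtain ⟨β, hβ, H⟩ := hctx (max p.length q.length)
      refine (CTermGraph.le_iff.1 (hmeet β hβ)).1 p q ((QuotTree.shares_iff _).2 ⟨?_, ?_, ?_⟩)
      · rintro _ ⟨ι, h₁, h₂, rfl⟩
        exact ((H ι h₁ h₂).shares p q (le_max_left _ _) (le_max_right _ _)).2 h
      · exact hpre _ β H p (le_max_left _ _) h.left
      · exact hpre _ β H q (le_max_right _ _) h.right
    · obtain ⟨β, hβ, H⟩ := hctx (p.length + 1)
      have hpc := hpre _ β H p (Nat.le_succ _) h.shares
      refine (CTermGraph.le_iff.1 (hmeet β hβ)).2 p f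
        ((QuotTree.labAt_iff _).2 ⟨⟨?_, hpc, hpc⟩, ?_⟩)
      · rintro _ ⟨ι, h₁, h₂, rfl⟩
        exact ((H ι h₁ h₂).shares p p (Nat.le_succ _) (Nat.le_succ _)).2 h.shares
      · rintro _ ⟨ι, h₁, h₂, rfl⟩
        exact ((H ι h₁ h₂).labAt p _ (Nat.lt_succ_self _)).2 h

/-- The limit inferior `G` fixes the labels at short positions: from some stage on, all reduction
contexts carry all symbols other than `⊥` that `G` has at positions of length at most `d`. -/
theorem Reduction.eventually_labAt_context (S : Reduction.{u, v, x, y} R) {l : Ordinal.{y}}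
    (hl : 0 < l) {b : Ordinal.{y} → CTermGraph Sg.withBot} {G : CTermGraph Sg.withBot}
    (hglb : ∀ β < l, IsGLB (S.contextsFrom l β) (b β))
    (hlab : ∀ p f, G.LabAt p (some f) → ∃ β < l, (b β).LabAt p (some f)) (d : ℕ) :
    ∃ β < l, ∀ ι, β ≤ ι → ι < l → ∀ (p : List ℕ) (f : Sg.Sym), p.length ≤ d →
      G.LabAt p (some f) → (S.context ι).LabAt p (some f) := by
  have key : ∀ F : Set (List ℕ), F.Finite → ∃ β < l, ∀ ι, β ≤ ι → ι < l →
      ∀ p ∈ F, ∀ f, G.LabAt p (some f) → (S.context ι).LabAt p (some f) := by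
    intro F hF
    induction F, hF using Set.Finite.induction_on with
    | empty => exact ⟨0, hl, fun _ _ _ p hp => absurd hp (Set.notMem_empty p)⟩
    | @insert p F _ _ ih =>
      obtain ⟨β, hβ, H⟩ := ih
      by_cases hp : ∃ f, G.LabAt p (some f)
      · obtain ⟨f, hf⟩ := hp
        obtain ⟨γ, hγ, hγf⟩ := hlab p f hf
        refine ⟨max β γ, max_lt hβ hγ, fun ι h₁ h₂ q hq f' hf' => ?_⟩
        rcases hq with rfl | hq
        · obtain rfl := Option.some.inj (hf.unique hf')
          have := (hglb γ hγ).1 ⟨ι, (le_max_right _ _).trans h₁, h₂, rfl⟩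
          exact (CTermGraph.le_iff.1 this).2 _ _ hγf
        · exact H ι ((le_max_left _ _).trans h₁) h₂ q hq f' hf'
      · refine ⟨β, hβ, fun ι h₁ h₂ q hq f' hf' => ?_⟩
        rcases hq with rfl | hq
        · exact absurd ⟨f', hf'⟩ hp
        · exact H ι h₁ h₂ q hq f' hf'
  obtain ⟨β, hβ, H⟩ := key _ (G.graph.finite_positions G.graph.root d)
  exact ⟨β, hβ, fun ι h₁ h₂ p f hp hf => H ι h₁ h₂ p ⟨hp, hf.shares⟩ f hf⟩

/-- If `c` has the labels of the total graph `G` at all positions of `G` of length at most `d`, then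
`c` has no further positions of length at most `d`. -/
theorem CTermGraph.IsTotal.shares_of_labAt {G c : CTermGraph Sg.withBot} (hG : G.IsTotal) {d : ℕ}
    (H : ∀ (p : List ℕ) (f : Sg.Sym), p.length ≤ d → G.LabAt p (some f) → c.LabAt p (some f))
    {p : List ℕ} (hp : p.length ≤ d) (hc : c.Shares p p) : G.Shares p p := by
  induction p using List.reverseRecOn with
  | nil => exact Graph.shares_nil _ _
  | append_singleton p i ih =>
    rw [List.length_append, List.length_singleton] at hp
    obtain ⟨f, hf, hi⟩ := CTermGraph.exists_labAt_of_snoc hc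
    have hs := ih (by omega) hf.shares
    obtain ⟨f', hf'⟩ := hG.exists_labAt hs
    obtain rfl := Option.some.inj (hf.unique (H p f' (by omega) hf'))
    exact hf'.shares_snoc hs hi

/-- If all redexes contracted from stage `β` on are deeper than `d`, then the term graphs remain
unchanged up to depth `d`, also across limits. -/
theorem Reduction.agreeTo_of_lt_redexDepth (S : Reduction.{u, v, x, y} R) {l β : Ordinal.{y}}
    {d : ℕ} (hlen : l ≤ S.len)
    (hcont : ∀ μ < l, Order.IsSuccLimit μ → IsSLim S.graph μ (S.graph μ))
    (hdepth : ∀ ι, β ≤ ι → ι < l → d < S.redexDepth ι) (ι : Ordinal.{y}) (hβ : β ≤ ι)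
    (hι : ι < l) : (S.graph β).AgreeTo d (S.graph ι) := by
  induction ι using Ordinal.limitRecOn with
  | zero =>
    obtain rfl := nonpos_iff_eq_zero.1 hβ
    exact .refl _ _ _
  | add_one ι ih =>
    rw [← Order.succ_eq_add_one] at hβ hι ⊢
    rcases hβ.eq_or_lt with rfl | hlt
    · exact .refl _ _ _
    · have hβι := Order.lt_succ_iff.1 hlt
      have hιl := (Order.lt_succ ι).trans hι
      exact (ih hβι hιl).trans (S.agreeTo_succ (hιl.trans_le hlen) (hdepth ι hβι hιl))
  | limit ι hlim ih =>
    rcases hβ.eq_or_lt with rfl | hlt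
    · exact .refl _ _ _
    · obtain ⟨γ, hγ, H⟩ := isSLim_iff.1 (hcont ι hι hlim) d
      have hm := max_lt hlt hγ
      exact (ih _ hm (le_max_left _ _) (hm.trans hι)).trans (H _ (le_max_right _ _) hm)

/-- A total limit inferior of the reduction contexts is the limit of the term graphs, and the depth
of the redexes tends to infinity. -/
theorem Reduction.isSLim_of_isSLiminf (S : Reduction.{u, v, x, y} R) {l : Ordinal.{y}}
    (hl : 0 < l) (hlen : l ≤ S.len)
    (hcont : ∀ μ < l, Order.IsSuccLimit μ → IsSLim S.graph μ (S.graph μ))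
    {G : CTermGraph Sg.withBot} (hG : G.IsTotal) (hlim : IsSLiminf S.context l G) :
    IsSLim S.graph l G ∧ TendsToInfty S.redexDepth l := by
  obtain ⟨b, hglb, hlub⟩ := hlim
  change ∀ β < l, IsGLB (S.contextsFrom l β) (b β) at hglb
  have hbc : ∀ β ι, β ≤ ι → ι < l → b β ≤ S.context ι := fun β ι h₁ h₂ =>
    (hglb β (h₁.trans_lt h₂)).1 ⟨ι, h₁, h₂, rfl⟩
  have hmono : ∀ β γ, β ≤ γ → γ < l → b β ≤ b γ := by
    intro β γ h₁ h₂
    refine (hglb γ h₂).2 ?_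
    rintro _ ⟨ι, h₃, h₄, rfl⟩
    exact hbc β ι (h₁.trans h₃) h₄
  have hdir : ∀ g ∈ {c | ∃ β < l, c = b β}, ∀ h ∈ {c | ∃ β < l, c = b β},
      ∃ k ∈ {c | ∃ β < l, c = b β}, g ≤ k ∧ h ≤ k := by
    rintro _ ⟨β, hβ, rfl⟩ _ ⟨γ, hγ, rfl⟩
    have hm := max_lt hβ hγ
    exact ⟨_, ⟨max β γ, hm, rfl⟩, hmono _ _ (le_max_left _ _) hm, hmono _ _ (le_max_right _ _) hm⟩
  obtain ⟨hsh, hla⟩ := exists_of_isLUB (B := {c | ∃ β < l, c = b β}) ⟨b 0, 0, hl, rfl⟩ hdir hlub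
  have hlab : ∀ p f, G.LabAt p (some f) → ∃ β < l, (b β).LabAt p (some f) := by
    intro p f h
    obtain ⟨_, ⟨β, hβ, rfl⟩, h'⟩ := hla p f h
    exact ⟨β, hβ, h'⟩
  -- a redex of depth at most `d` would give the context a `⊥` at a position where it has to carry
  -- a label of `G`
  have hdepth : ∀ d, ∃ β < l, ∀ ι, β ≤ ι → ι < l → d < S.redexDepth ι ∧
      ∀ (p : List ℕ) (f : Sg.Sym), p.length ≤ d →
        G.LabAt p (some f) → (S.context ι).LabAt p (some f) := by
    intro d
    obtain ⟨β, hβ, H⟩ := S.eventually_labAt_context hl hglb hlab d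
    refine ⟨β, hβ, fun ι h₁ h₂ => ⟨?_, H ι h₁ h₂⟩⟩
    by_contra! hle
    obtain ⟨p, hp, hn⟩ := TermGraph.exists_labAt_ltrunc (S.graph ι).graph (S.node ι)
    have hpd : p.length ≤ d := hp.trans_le hle
    have hn : (S.context ι).LabAt p none := hn
    obtain ⟨f, hf⟩ := hG.exists_labAt (hG.shares_of_labAt (H ι h₁ h₂) hpd hn.shares)
    have := hn.unique (H ι h₁ h₂ p f hpd hf)
    cases this
  refine ⟨isSLim_iff.2 fun d => ?_, fun d => ?_⟩
  · obtain ⟨β, hβ, H⟩ := hdepth d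
    refine ⟨β, hβ, fun ι hι hιl => ?_⟩
    have hgg := S.agreeTo_of_lt_redexDepth hlen hcont fun ι h₁ h₂ => (H ι h₁ h₂).1
    have hcg : ∀ κ, β ≤ κ → κ < l → (S.context κ).AgreeTo d (S.graph ι) := fun κ h₁ h₂ =>
      (S.agreeTo_context (H κ h₁ h₂).1.le).trans ((hgg κ h₁ h₂).symm.trans (hgg ι hι hιl))
    have hsub : ∀ p q : List ℕ, p.length ≤ d → q.length ≤ d → (S.graph ι).Shares p q →
        G.Shares p q := by
      intro p q hp hq h
      -- short positions of the contexts are positions of `G`, so no `⊥` occurs above them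
      have hpre : ∀ p : List ℕ, p.length ≤ d → (S.graph ι).Shares p p →
          CommonPrefixes (S.contextsFrom l β) p := by
        rintro p hp hs r i ⟨r', rfl⟩
        have hc := ((hcg ι hι hιl).shares _ _ hp hp).2 hs
        have hGp := hG.shares_of_labAt (H ι hι hιl).2 hp hc
        obtain ⟨f, hf, -⟩ := CTermGraph.exists_labAt_of_snoc hGp.of_append
        refine ⟨f, ?_⟩
        rintro _ ⟨κ, h₁, h₂, rfl⟩
        refine (H κ h₁ h₂).2 r f ?_ hf
        simp only [List.length_append, List.length_singleton] at hp
        omega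
      have hmeet := (hglb β hβ).2
        (isGLB_meetTree _ (S.contextsFrom_nonempty hβ)).1
      have hbG : b β ≤ G := hlub.1 ⟨β, hβ, rfl⟩
      refine (CTermGraph.le_iff.1 hbG).1 p q ((CTermGraph.le_iff.1 hmeet).1 p q
        ((QuotTree.shares_iff _).2 ⟨?_, hpre p hp h.left, hpre q hq h.right⟩))
      rintro _ ⟨κ, h₁, h₂, rfl⟩
      exact ((hcg κ h₁ h₂).shares p q hp hq).2 h
    have hlabG : ∀ (p : List ℕ) (f : Sg.Sym), p.length < d → G.LabAt p (some f) →
        (S.graph ι).LabAt p (some f) := fun p f hp hf =>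
      ((hcg ι hι hιl).labAt p _ hp).1 ((H ι hι hιl).2 p f hp.le hf)
    refine ⟨fun p q hp hq => ⟨hsub p q hp hq, fun h => ?_⟩,
      fun p s hp => ⟨fun h => ?_, fun h => ?_⟩⟩
    · obtain ⟨_, ⟨γ, hγ, rfl⟩, h'⟩ := hsh p q h
      have hm := max_lt hβ hγ
      exact ((hcg _ (le_max_left _ _) hm).shares p q hp hq).1
        ((CTermGraph.le_iff.1 (hbc γ _ (le_max_right _ _) hm)).1 p q h')
    · obtain ⟨f, hf⟩ := hG.exists_labAt (hsub p p hp.le hp.le h.shares)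
      rwa [h.unique (hlabG p f hp hf)]
    · obtain ⟨f, hf⟩ := hG.exists_labAt h.shares
      obtain rfl := h.unique hf
      exact hlabG p f hp h
  · obtain ⟨β, hβ, H⟩ := hdepth d
    exact ⟨β, hβ, fun ι h₁ h₂ => (H ι h₁ h₂).1.le⟩

theorem Reduction.lt_seqLen (S : Reduction.{u, v, x, y} R) {ι : Ordinal.{y}} (h : ι < S.len) :
    ι < S.seqLen := by
  unfold Reduction.seqLen
  split_ifs
  · exact h
  · exact h.trans (Order.lt_succ _)

/-- Strong `p`-continuity of a reduction in which all term graphs are total entails strong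
`m`-continuity, by induction on the limit ordinals below its length. -/
theorem Reduction.StronglyPContinuous.stronglyMContinuous {S : Reduction.{u, v, x, y} R}
    (hS : S.StronglyPContinuous) (htot : S.IsTotal) : S.StronglyMContinuous := by
  intro l
  induction l using WellFoundedLT.induction with
  | ind l ih =>
    intro hl hlim
    exact S.isSLim_of_isSLiminf hlim.bot_lt hl.le
      (fun μ hμ hμlim => (ih μ hμ (hμ.trans hl) hμlim).1) (htot l (S.lt_seqLen hl)) (hS l hl hlim)

end Convergence

end TGR

theorem mainTheorem1 {Sg : TGR.Signature.{u}} {V : Type v}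
    (R : TGR.GRS.{u, v, x} Sg V) (S : TGR.Reduction.{u, v, x, y} R.withBot)
    (g h : TGR.CTermGraph Sg.withBot) :
    S.StronglyMConverges g h ↔ (S.StronglyPConverges g h ∧ S.IsTotal ∧ h.IsTotal) := by
  constructor
  · rintro ⟨h0, htot, hh, hcont, hend⟩
    refine ⟨⟨h0, fun l hl hlim => ?_, hend.imp_right ?_⟩, htot, hh⟩
    · exact S.isSLiminf_of_isSLim (hcont l hl hlim).1
        (hcont l hl hlim).2
    · rintro ⟨hopen, hlim, hdepth⟩
      exact ⟨hopen, S.isSLiminf_of_isSLim hlim hdepth⟩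
  · rintro ⟨⟨h0, hcont, hend⟩, htot, hh⟩
    have hcont := hcont.stronglyMContinuous htot
    refine ⟨h0, htot, hh, hcont, hend.imp_right ?_⟩
    rintro ⟨hopen, hlim⟩
    exact ⟨hopen, S.isSLim_of_isSLiminf (Order.IsSuccLimit.bot_lt hopen) le_rfl
      (fun μ hμ hμlim => (hcont μ hμ hμlim).1) hh hlim⟩
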